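/- All orders are linear orders, countable means finite or countably infinite, and $\cong$ means order-isomorphic. For orders $A, X$, the product $AX$ is $A\times X$ ordered lexicographically with the $A$-coordinate compared first; $X$ is *left-absorbing* if $AX\cong X$ for some order $A$ with at least two points. For a non-empty countable index set $N$, countable orders $I_k$ ($k\in N$) and a partition $\mathbb{Q}=\bigcup_{k\in N}Q_k$ into sets dense in $\mathbb{Q}$, the *shuffle* $\mathbb{Q}[I_k]$ is the order obtained from $\mathbb{Q}$ by replacing each $q\in Q_k$ by a copy of $I_k$ (up to isomorphism it does not depend on the partition). The collection $\{I_k\}$ is *minimal* if no $I_k$ contains a convex subset isomorphic to $\mathbb{Q}[I_k]$. **Theorem.** Let $X$ be a non-empty countable linear order. Then $X$ is left-absorbing if and only if there are a countable minimal collection $\{I_k\}$ of non-empty countable orders and countable (possibly empty) orders $L, R$ such that $X\cong L+\mathbb{Q}[I_k]+R$ and exactly one of the following holds: 1. $L=R=\emptyset$; 2. $L\cong I_k$ for some $k$, and $R=\emptyset$; 3. $R\cong I_k$ for some $k$, and $L=\emptyset$; 4. $L\cong I_{k_1}$ and $R\cong I_{k_2}$ for some $k_1,k_2$, but $R+L\not\cong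 I_k$ for all $k$; 5. $R+L\cong I_{k_0}$ for some $k_0$, but $L\not\cong I_k$ and $R\not\cong I_k$ for all $k$; 6. $R\neq\emptyset$, $R+L\cong I_{k_0}$ and $L\cong I_{k_1}$ for some $k_0,k_1$, but $R\not\cong I_k$ for all $k$; 7. $L\neq\emptyset$, $R+L\cong I_{k_0}$ and $R\cong I_{k_1}$ for some $k_0,k_1$, but $L\not\cong I_k$ for all $k$; 8. $R+L\cong I_{k_0}$, $L\cong I_{k_1}$ and $R\cong I_{k_2}$ for some $k_0,k_1,k_2$. Moreover, for every such representation of $X$ and every countable order $A$: * (i) if (1) holds, then $AX\cong X$ if and only if $A$ is non-empty (so $X$ absorbs every non-empty countable $A$); * (ii) if (2) holds, then $AX\cong X$ if and only if $A$ has a left endpoint; * (iii) if (3) holds, then $AX\cong X$ if and only if $A$ has a right endpoint; * (iv) if (4) holds, then $AX\cong X$ if and only if $A\cong 1+\mathbb{Q}+1$ or $A\cong 1$; * (v) if (5) holds, then $AX\cong X$ if and only if $A$ has a left and a right endpoint, every point of $A$ other than the right endpoint has a successor, and every point of $A$ other than the left endpoint has a predecessor; * (vi) if (6) holds, then $AX\cong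 X$ if and only if $A$ has a left and a right endpoint and every point of $A$ other than the right endpoint has a successor; * (vii) if (7) holds, then $AX\cong X$ if and only if $A$ has a left and a right endpoint and every point of $A$ other than the left endpoint has a predecessor; * (viii) if (8) holds, then $AX\cong X$ if and only if $A$ has a left and a right endpoint. In particular, $AX\cong X$ for every non-empty countable order $A$ if and only if $X$ is isomorphic to a shuffle $\mathbb{Q}[I_k]$ of countable orders. -/

import Mathlib

universe u

/-- `X` and `Y` are order-isomorphic. -/
def OrdIso (X Y : Type*) [LinearOrder X] [LinearOrder Y] : Prop := Nonempty (X ≃o Y)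

/-- `X ≅ₒ Y`: the linear orders `X` and `Y` are order-isomorphic. -/
notation:50 X:51 " ≅ₒ " Y:51 => OrdIso X Y

/-- `A` absorbed by `X` on the left: `AX ≅ X`, where `AX = A ×ₗ X` is the lexicographic product in
which the coordinate in `A` is compared first (every point of `A` is replaced by a copy of `X`). -/
def LeftAbsorbs (X A : Type u) [LinearOrder X] [LinearOrder A] : Prop :=
  (A ×ₗ X) ≅ₒ X

/-- `X` is left-absorbing: `AX ≅ X` for some linear order `A` with at least two points. -/
def LeftAbsorbing (X : Type u) [LinearOrder X] : Prop :=
  ∃ (A : Type u) (_ : LinearOrder A), Nontrivial A ∧ LeftAbsorbs X A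

/-- `X` contains a convex copy of `Y`: some interval (convex subset) of `X` is isomorphic to `Y`. -/
def ContainsConvexCopy (X Y : Type*) [LinearOrder X] [LinearOrder Y] : Prop :=
  ∃ S : Set X, S.OrdConnected ∧ S ≅ₒ Y

/-- The partition of `ℚ` into the fibres `c ⁻¹' {k}` consists of dense subsets of `ℚ`. -/
def IsDensePartition {K : Type} (c : ℚ → K) : Prop :=
  ∀ k : K, Dense (c ⁻¹' {k})

/-- The replacement `ℚ[I_k]` of `ℚ` in which every `q` with `c q = k` is replaced by `I k`, ordered
lexicographically. It is a shuffle of the orders `I k` when `c` is a dense partition. -/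
abbrev Shuffle {K : Type} (I : K → Type u) (c : ℚ → K) : Type u :=
  Σₗ q : ℚ, I (c q)

/-- `X` is (isomorphic to) a shuffle of some non-empty countable collection of countable orders.
The index type is non-empty because it is the target of a map from `ℚ`. -/
def IsShuffle (X : Type u) [LinearOrder X] : Prop :=
  ∃ (K : Type) (I : K → Type u) (_ : ∀ k, LinearOrder (I k)) (c : ℚ → K),
    Countable K ∧ (∀ k, Countable (I k)) ∧ IsDensePartition c ∧ X ≅ₒ Shuffle I c

/-- `{I k}` is a countable minimal collection of non-empty countable orders, shuffled along the
dense partition `c` of `ℚ`: no `I k` contains a convex copy of the shuffle `ℚ[I_k]`. -/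
structure IsMinimalCollection {K : Type} (I : K → Type u) [∀ k, LinearOrder (I k)]
    (c : ℚ → K) : Prop where
  countable_index : Countable K
  countable : ∀ k, Countable (I k)
  nonempty : ∀ k, Nonempty (I k)
  dense : IsDensePartition c
  minimal : ∀ k, ¬ ContainsConvexCopy (I k) (Shuffle I c)

/-- `L` is isomorphic to one of the orders `I k`. -/
def IsoToMember {K : Type} (I : K → Type u) [∀ k, LinearOrder (I k)]
    (L : Type u) [LinearOrder L] : Prop :=
  ∃ k, L ≅ₒ I k

/-- The eight conditions on `L`, `R` and the collection `{I k}`, numbered from 1 to 8. -/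
def EndCondition {K : Type} (I : K → Type u) [∀ k, LinearOrder (I k)]
    (L R : Type u) [LinearOrder L] [LinearOrder R] : ℕ → Prop
  | 1 => IsEmpty L ∧ IsEmpty R
  | 2 => IsoToMember I L ∧ IsEmpty R
  | 3 => IsoToMember I R ∧ IsEmpty L
  | 4 => IsoToMember I L ∧ IsoToMember I R ∧ ¬ IsoToMember I (R ⊕ₗ L)
  | 5 => IsoToMember I (R ⊕ₗ L) ∧ ¬ IsoToMember I L ∧ ¬ IsoToMember I R
  | 6 => Nonempty R ∧ IsoToMember I (R ⊕ₗ L) ∧ IsoToMember I L ∧ ¬ IsoToMember I R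
  | 7 => Nonempty L ∧ IsoToMember I (R ⊕ₗ L) ∧ IsoToMember I R ∧ ¬ IsoToMember I L
  | 8 => IsoToMember I (R ⊕ₗ L) ∧ IsoToMember I L ∧ IsoToMember I R
  | _ => False

/-- `A` has a left endpoint. -/
def HasLeftEndpoint (A : Type*) [LinearOrder A] : Prop := ∃ a : A, IsBot a

/-- `A` has a right endpoint. -/
def HasRightEndpoint (A : Type*) [LinearOrder A] : Prop := ∃ a : A, IsTop a

/-- Every point of `A` other than the right endpoint has a successor. -/
def HasSuccessors (A : Type*) [LinearOrder A] : Prop := ∀ a : A, ¬ IsTop a → ∃ b, a ⋖ b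

/-- Every point of `A` other than the left endpoint has a predecessor. -/
def HasPredecessors (A : Type*) [LinearOrder A] : Prop := ∀ a : A, ¬ IsBot a → ∃ b, b ⋖ a

/-!
A convex copy of `P` that is cut in two leaves a convex copy of `P` in one of the parts, as soon as
`P` contains two disjoint convex copies of itself (`HasCopy.or_of_cut`). Hence for such a `P`, in
every linear order, the relation "the interval between `x` and `y` contains no convex copy of `P`"
(`Close P x y`) is an equivalence relation with convex classes, the blocks. It is preserved by
isomorphisms, the blocks are densely ordered (`exists_between_not_close`), and a convex embedding
maps every block that is neither the least nor the greatest one onto a block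
(`ConvexEmb.block_eq`). So a countable order is determined by its least block, its greatest block
and the types of its inner blocks, provided that every inner type that occurs does so between any
two blocks (`ordIso_shuffle_of_blocks`, from Skolem's version of Cantor's theorem).

If `A X ≅ X` with `A` nontrivial, `X` itself can be taken for `P`: between any two blocks of `X` there
is a copy of `X`, thus every type of inner block. Therefore `X ≅ L + ℚ[I_k] + R`, where the `I_k` are
the types of the inner blocks and `L`, `R` are the end blocks; the collection is minimal because a
block contains no copy of `X` (`SelfDoubling.exists_decomposition`).

Given `X = L + ℚ[I_k] + R` for a minimal collection, take `P = ℚ[I_k]`. The blocks of `A X` are the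
copies of the `I_k`, a copy of `R + L` at every jump of `A`, and copies of `R` and `L` at the points of
`A` without successor and without predecessor. Comparing with the blocks of `X` yields that `A` is
absorbed if and only if it has the endpoints that non-empty `L` and `R` require and all inner blocks
of `A X` are members of the collection (`IsMinimalCollection.leftAbsorbs_iff`). The eight conditions
are the possible outcomes of this criterion. For the last assertion, `ℚ X` is the shuffle of the single
order `X`, so an `X` that absorbs `ℚ` is a shuffle.
-/

open Set

/-! ### Convex embeddings -/

/-- `g` is an isomorphism of `α` onto a convex subset of `β`. -/
structure ConvexEmb {α β : Type*} [LinearOrder α] [LinearOrder β] (g : α → β) : Prop where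
  strictMono : StrictMono g
  exists_eq : ∀ {a b : α} {z : β}, g a ≤ z → z ≤ g b → ∃ w, g w = z

/-- The set `s` contains a convex copy of `P`, where convexity refers to the ambient order `Z`, not
to `s`. -/
def HasCopy (P : Type*) [LinearOrder P] {Z : Type*} [LinearOrder Z] (s : Set Z) : Prop :=
  ∃ g : P → Z, ConvexEmb g ∧ ∀ p, g p ∈ s

section ConvexEmb

variable {α β γ : Type*} [LinearOrder α] [LinearOrder β] [LinearOrder γ]

theorem ConvexEmb.comp {g : β → γ} {f : α → β} (hg : ConvexEmb g) (hf : ConvexEmb f) :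
    ConvexEmb (g ∘ f) where
  strictMono := hg.strictMono.comp hf.strictMono
  exists_eq {a b z} h₁ h₂ := by
    obtain ⟨w, rfl⟩ := hg.exists_eq h₁ h₂
    obtain ⟨v, rfl⟩ := hf.exists_eq (hg.strictMono.le_iff_le.1 h₁) (hg.strictMono.le_iff_le.1 h₂)
    exact ⟨v, rfl⟩

theorem OrderIso.convexEmb (e : α ≃o β) : ConvexEmb e :=
  ⟨e.strictMono, fun _ _ => ⟨e.symm _, e.apply_symm_apply _⟩⟩

theorem Set.OrdConnected.convexEmb_val {s : Set α} (hs : s.OrdConnected) :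
    ConvexEmb (Subtype.val : s → α) :=
  ⟨fun _ _ h => h, fun {a b z} h₁ h₂ => ⟨⟨z, hs.out a.2 b.2 ⟨h₁, h₂⟩⟩, rfl⟩⟩

theorem ConvexEmb.ordConnected_range {g : α → β} (hg : ConvexEmb g) : (range g).OrdConnected :=
  ⟨by rintro _ ⟨a, rfl⟩ _ ⟨b, rfl⟩ z hz; exact hg.exists_eq hz.1 hz.2⟩

theorem StrictMono.ordIso_range {g : α → β} (hg : StrictMono g) : range g ≅ₒ α :=
  ⟨(hg.orderIso g).symm⟩

theorem OrdIso.symm (h : α ≅ₒ β) : β ≅ₒ α := h.map OrderIso.symm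

theorem OrdIso.trans (h₁ : α ≅ₒ β) (h₂ : β ≅ₒ γ) : α ≅ₒ γ :=
  h₁.elim fun e₁ => h₂.elim fun e₂ => ⟨e₁.trans e₂⟩

theorem StrictMono.ordIso {g : α → β} (hg : StrictMono g) (h : Function.Surjective g) : α ≅ₒ β :=
  ⟨hg.orderIsoOfSurjective g h⟩

theorem containsConvexCopy_iff : ContainsConvexCopy α β ↔ HasCopy β (univ : Set α) := by
  constructor
  · rintro ⟨s, hs, ⟨e⟩⟩
    exact ⟨_, hs.convexEmb_val.comp e.symm.convexEmb, fun _ => mem_univ _⟩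
  · rintro ⟨g, hg, -⟩
    exact ⟨range g, hg.ordConnected_range, hg.strictMono.ordIso_range⟩

end ConvexEmb

section HasCopy

variable {P Q Y Z : Type*} [LinearOrder P] [LinearOrder Q] [LinearOrder Y] [LinearOrder Z]

theorem HasCopy.mono {s t : Set Z} (h : HasCopy P s) (hst : s ⊆ t) : HasCopy P t :=
  let ⟨g, hg, hs⟩ := h; ⟨g, hg, fun p => hst (hs p)⟩

theorem HasCopy.trans {s : Set Z} (h : HasCopy P s) (hQ : HasCopy Q (univ : Set P)) :
    HasCopy Q s :=
  let ⟨g, hg, hs⟩ := h; let ⟨f, hf, _⟩ := hQ; ⟨g ∘ f, hg.comp hf, fun p => hs (f p)⟩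

theorem HasCopy.image {s : Set Y} (h : HasCopy P s) {e : Y → Z} (he : ConvexEmb e) :
    HasCopy P (e '' s) :=
  let ⟨g, hg, hs⟩ := h; ⟨e ∘ g, he.comp hg, fun p => mem_image_of_mem e (hs p)⟩

theorem HasCopy.preimage {s : Set Z} (h : HasCopy P s) {e : Y → Z} (he : ConvexEmb e)
    (hs : s ⊆ range e) : HasCopy P (e ⁻¹' s) := by
  obtain ⟨g, hg, hgs⟩ := h
  choose f hf using fun p => hs (hgs p)
  refine ⟨f, ⟨fun p q hpq => ?_, fun {a b z} h₁ h₂ => ?_⟩, fun p => ?_⟩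
  · rw [← he.strictMono.lt_iff_lt, hf, hf]; exact hg.strictMono hpq
  · rw [← he.strictMono.le_iff_le, hf] at h₁ h₂
    obtain ⟨w, hw⟩ := hg.exists_eq h₁ h₂
    exact ⟨w, he.strictMono.injective ((hf w).trans hw)⟩
  · rw [mem_preimage, hf]; exact hgs p

end HasCopy

/-! ### Self-doubling orders and the condensation they induce -/

/-- `P` contains two disjoint convex copies of itself. -/
def SelfDoubling (P : Type*) [LinearOrder P] : Prop :=
  Nonempty P ∧ ∃ f g : P → P, ConvexEmb f ∧ ConvexEmb g ∧ ∀ x y, f x < g y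

/-- `x` and `y` are `P`-close if the interval between them contains no convex copy of `P`. -/
def Close (P : Type*) [LinearOrder P] {Z : Type*} [LinearOrder Z] (x y : Z) : Prop :=
  ¬ HasCopy P (uIcc x y)

/-- The set of points that are `P`-close to `x`. -/
def block (P : Type*) [LinearOrder P] {Z : Type*} [LinearOrder Z] (x : Z) : Set Z :=
  {y | Close P x y}

/-- `x` lies neither in the least nor in the greatest block. -/
def IsInner (P : Type*) [LinearOrder P] {Z : Type*} [LinearOrder Z] (x : Z) : Prop :=
  (∃ w, w < x ∧ ¬ Close P w x) ∧ ∃ y, x < y ∧ ¬ Close P x y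

section Close

variable {P Y Z : Type*} [LinearOrder P] [LinearOrder Y] [LinearOrder Z]

theorem Close.symm {x y : Z} (h : Close P x y) : Close P y x := by
  rwa [Close, uIcc_comm]

theorem close_comm {x y : Z} : Close P x y ↔ Close P y x := ⟨.symm, .symm⟩

theorem close_of_not_hasCopy {s : Set Z} (hs : s.OrdConnected) (h : ¬ HasCopy P s) {x y : Z}
    (hx : x ∈ s) (hy : y ∈ s) : Close P x y :=
  fun h' => h (h'.mono (hs.uIcc_subset hx hy))

theorem Close.of_mem {w x y z : Z} (h : Close P w z) (hx : x ∈ uIcc w z) (hy : y ∈ uIcc w z) :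
    Close P x y :=
  fun h' => h (h'.mono (ordConnected_uIcc.uIcc_subset hx hy))

/-- A convex copy of `P` that is cut into two parts has a convex copy of `P` in one of them, since
one of two disjoint copies of `P` inside it avoids the cut. -/
theorem HasCopy.or_of_cut (hP : SelfDoubling P) {r s t : Set Z} (h : HasCopy P r)
    (hr : r ⊆ s ∪ t) (hst : ∀ x ∈ s, ∀ y ∈ t, x ≤ y) : HasCopy P s ∨ HasCopy P t := by
  obtain ⟨g, hg, hgr⟩ := h
  obtain ⟨-, f₀, f₁, h₀, h₁, hlt⟩ := hP
  by_cases H : ∀ p, g (f₀ p) ∈ s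
  · exact .inl ⟨_, hg.comp h₀, H⟩
  · push Not at H
    obtain ⟨p, hp⟩ := H
    have hp' := (hr (hgr (f₀ p))).resolve_left hp
    refine .inr ⟨_, hg.comp h₁, fun q => (hr (hgr (f₁ q))).resolve_left fun hq => ?_⟩
    exact (hg.strictMono (hlt p q)).not_ge (hst _ hq _ hp')

theorem close_refl (hP : SelfDoubling P) (x : Z) : Close P x x := by
  rintro ⟨g, hg, h⟩
  obtain ⟨⟨p⟩, f₀, f₁, -, -, hlt⟩ := hP
  have h₀ := h (f₀ p)
  have h₁ := h (f₁ p)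
  simp only [uIcc_self, mem_singleton_iff] at h₀ h₁
  exact (hg.strictMono (hlt p p)).ne (h₀.trans h₁.symm)

theorem Close.trans (hP : SelfDoubling P) {x y z : Z} (h₁ : Close P x y) (h₂ : Close P y z) :
    Close P x z := by
  have key : ∀ {x z : Z}, x ≤ z → Close P x y → Close P y z → Close P x z := by
    intro x z hxz h₁ h₂
    rcases le_total y x with hyx | hxy
    · exact h₂.of_mem (by rw [mem_uIcc]; exact .inl ⟨hyx, hxz⟩) right_mem_uIcc
    rcases le_total z y with hzy | hyz
    · exact h₁.of_mem left_mem_uIcc (by rw [mem_uIcc]; exact .inl ⟨hxz, hzy⟩)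
    intro h
    have hcut := h.or_of_cut hP (s := uIcc x y) (t := uIcc y z) uIcc_subset_uIcc_union_uIcc (by
      rw [uIcc_of_le hxy, uIcc_of_le hyz]
      exact fun a ha b hb => ha.2.trans hb.1)
    exact hcut.elim h₁ h₂
  rcases le_total x z with h | h
  · exact key h h₁ h₂
  · exact (key h h₂.symm h₁.symm).symm

theorem mem_block_self (hP : SelfDoubling P) (x : Z) : x ∈ block P x := close_refl hP x

theorem block_eq (hP : SelfDoubling P) {x y : Z} (h : Close P x y) : block P x = block P y :=
  Set.ext fun _ => ⟨fun h' => h.symm.trans hP h', fun h' => h.trans hP h'⟩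

theorem ordConnected_block (hP : SelfDoubling P) (x : Z) : (block P x).OrdConnected :=
  ⟨fun a ha b hb _ hz => Close.trans hP ha
    ((ha.symm.trans hP hb : Close P a b).of_mem left_mem_uIcc (Icc_subset_uIcc hz))⟩

/-- A self-doubling order contains a copy of itself bounded by two of its points. -/
theorem SelfDoubling.exists_bounded (hP : SelfDoubling P) :
    ∃ (x y : P) (g : P → P), ConvexEmb g ∧ ∀ p, x < g p ∧ g p < y := by
  obtain ⟨⟨p⟩, f₀, f₁, h₀, h₁, hlt⟩ := hP
  exact ⟨f₀ p, f₁ (f₁ p), _, h₁.comp h₀, fun q => ⟨hlt _ _, h₁.strictMono (hlt _ _)⟩⟩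

theorem SelfDoubling.exists_not_close (hP : SelfDoubling P) {s : Set Z} (h : HasCopy P s) :
    ∃ x ∈ s, ∃ y ∈ s, x < y ∧ ¬ Close P x y := by
  obtain ⟨x, y, f, hf, hxy⟩ := hP.exists_bounded
  obtain ⟨g, hg, hs⟩ := h
  obtain ⟨p⟩ := hP.1
  refine ⟨g x, hs x, g y, hs y, hg.strictMono ((hxy p).1.trans (hxy p).2), fun hc => hc ?_⟩
  exact ⟨_, hg.comp hf, fun q => Icc_subset_uIcc
    ⟨(hg.strictMono (hxy q).1).le, (hg.strictMono (hxy q).2).le⟩⟩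

/-- Although a block may be unbounded, it contains no convex copy of `P`. -/
theorem not_hasCopy_block (hP : SelfDoubling P) (x : Z) : ¬ HasCopy P (block P x) := by
  intro h
  obtain ⟨y, hy, z, hz, -, hyz⟩ := hP.exists_not_close h
  exact hyz (hy.symm.trans hP hz)

theorem block_eq_of_forall {s : Set Z} (hs : s.OrdConnected) (h : ¬ HasCopy P s) {x : Z}
    (hx : x ∈ s) (hs' : ∀ y ∉ s, ¬ Close P x y) : block P x = s :=
  Set.ext fun y => ⟨fun hy => by_contra fun h' => hs' y h' hy,
    fun hy => close_of_not_hasCopy hs h hx hy⟩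

/-- The blocks are densely ordered: if two blocks were adjacent, a copy of `P` between two of their
points would leave a copy of `P` in one of them. -/
theorem exists_between_not_close (hP : SelfDoubling P) {x y : Z} (hxy : x < y)
    (h : ¬ Close P x y) : ∃ z, x < z ∧ z < y ∧ ¬ Close P x z ∧ ¬ Close P z y := by
  by_contra! H
  have hc : HasCopy P (uIcc x y) := not_not.1 h
  rw [uIcc_of_le hxy.le] at hc
  have hcut := hc.or_of_cut hP (s := block P x ∩ Icc x y) (t := block P y ∩ Icc x y) ?_ ?_
  · rcases hcut with h' | h'
    · exact not_hasCopy_block hP x (h'.mono inter_subset_left)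
    · exact not_hasCopy_block hP y (h'.mono inter_subset_left)
  · intro z hz
    by_cases hxz : Close P x z
    · exact .inl ⟨hxz, hz⟩
    · refine .inr ⟨?_, hz⟩
      rcases hz.1.eq_or_lt with rfl | h₁
      · exact absurd (close_refl hP x) hxz
      rcases hz.2.eq_or_lt with rfl | h₂
      · exact close_refl hP z
      · exact (H z h₁ h₂ hxz).symm
  · intro s hs t ht
    by_contra! hlt
    exact h ((hs.1.of_mem left_mem_uIcc (Icc_subset_uIcc ⟨ht.2.1, hlt.le⟩) : Close P x t).trans hP
      ht.1.symm)

theorem ConvexEmb.close_iff {e : Y → Z} (he : ConvexEmb e) {x y : Y} :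
    Close P (e x) (e y) ↔ Close P x y := by
  have key : ∀ {x y : Y}, x ≤ y → (Close P (e x) (e y) ↔ Close P x y) := by
    intro x y hxy
    have hm := he.strictMono.monotone
    rw [Close, Close, uIcc_of_le hxy, uIcc_of_le (hm hxy), not_iff_not]
    constructor
    · intro h
      refine (h.preimage he ?_).mono ?_
      · exact fun z hz => he.exists_eq hz.1 hz.2
      · exact fun z hz => ⟨he.strictMono.le_iff_le.1 hz.1, he.strictMono.le_iff_le.1 hz.2⟩
    · intro h
      refine (h.image he).mono ?_
      rintro _ ⟨z, hz, rfl⟩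
      exact ⟨hm hz.1, hm hz.2⟩
  rcases le_total x y with h | h
  · exact key h
  · rw [close_comm, key h, close_comm]

theorem not_close_mono {w x y z : Z} (h : ¬ Close P x y) (hw : w ≤ x) (hxy : x ≤ y) (hz : y ≤ z) :
    ¬ Close P w z :=
  fun h' => h (h'.of_mem (Icc_subset_uIcc ⟨hw, hxy.trans hz⟩) (Icc_subset_uIcc ⟨hw.trans hxy, hz⟩))

/-- A convex embedding maps inner blocks onto blocks. -/
theorem ConvexEmb.block_eq {e : Y → Z} (he : ConvexEmb e) {x : Y} (hx : IsInner P x) :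
    block P (e x) = e '' block P x := by
  obtain ⟨⟨w, hwx, hw⟩, ⟨y, hxy, hy⟩⟩ := hx
  ext z
  constructor
  · intro hz
    have h₁ : e w ≤ z := by
      by_contra! h
      exact hw (he.close_iff.1 (Close.of_mem hz
        (by rw [mem_uIcc]; exact .inr ⟨h.le, (he.strictMono hwx).le⟩) left_mem_uIcc))
    have h₂ : z ≤ e y := by
      by_contra! h
      exact hy (he.close_iff.1 (Close.of_mem hz left_mem_uIcc
        (by rw [mem_uIcc]; exact .inl ⟨(he.strictMono hxy).le, h.le⟩)))
    obtain ⟨v, rfl⟩ := he.exists_eq h₁ h₂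
    exact ⟨v, he.close_iff.1 hz, rfl⟩
  · rintro ⟨v, hv, rfl⟩
    exact he.close_iff.2 hv

theorem ConvexEmb.block_ordIso {e : Y → Z} (he : ConvexEmb e) {x : Y} (hx : IsInner P x) :
    block P (e x) ≅ₒ block P x := by
  rw [he.block_eq hx]
  exact OrdIso.symm ⟨(he.strictMono.strictMonoOn _).orderIso e _⟩

theorem ConvexEmb.inner {e : Y → Z} (he : ConvexEmb e) {x : Y} (hx : IsInner P x) :
    IsInner P (e x) := by
  obtain ⟨⟨w, hwx, hw⟩, ⟨y, hxy, hy⟩⟩ := hx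
  exact ⟨⟨e w, he.strictMono hwx, mt he.close_iff.1 hw⟩, e y, he.strictMono hxy,
    mt he.close_iff.1 hy⟩

end Close

/-! ### Back and forth along a relation -/

section BackAndForth

variable {α β : Type*} [LinearOrder α] [LinearOrder β]

/-- A finite partial order isomorphism between `α` and `β`, given by its graph, that pairs only
`r`-related points. -/
def IsPartialIso (r : α → β → Prop) (f : Finset (α × β)) : Prop :=
  (∀ p ∈ f, r p.1 p.2) ∧ ∀ p ∈ f, ∀ q ∈ f, (p.1 < q.1 ↔ p.2 < q.2)

theorem IsPartialIso.exists_insert_left [DenselyOrdered β] [NoMinOrder β] [NoMaxOrder β]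
    [Nonempty β] {r : α → β → Prop} (hr : ∀ (a : α) (x y : β), x < y → ∃ b, x < b ∧ b < y ∧ r a b)
    {f : Finset (α × β)} (hf : IsPartialIso r f) (a : α) :
    ∃ b, IsPartialIso r (insert (a, b) f) := by
  by_cases h : ∃ b, (a, b) ∈ f
  · obtain ⟨b, hb⟩ := h
    exact ⟨b, by rwa [Finset.insert_eq_of_mem hb]⟩
  have hlt : ∀ x ∈ {p ∈ f | p.1 < a}.image Prod.snd, ∀ y ∈ {p ∈ f | a < p.1}.image Prod.snd,
      x < y := by
    intro x hx y hy
    simp only [Finset.mem_image, Finset.mem_filter] at hx hy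
    obtain ⟨p, ⟨hp, hpa⟩, rfl⟩ := hx
    obtain ⟨q, ⟨hq, hqa⟩, rfl⟩ := hy
    exact (hf.2 p hp q hq).1 (hpa.trans hqa)
  obtain ⟨m, hm₁, hm₂⟩ := Order.exists_between_finsets _ _ hlt
  -- all points between `m` and `m'` lie in the gap, so an `r`-partner of `a` can be chosen there
  obtain ⟨m', hm'₁, hm'₂⟩ := Order.exists_between_finsets {m} _
    (fun x hx y hy => (Finset.mem_singleton.1 hx).trans_lt (hm₂ y hy))
  obtain ⟨b, hmb, hbm, hab⟩ := hr a m m' (hm'₁ m (Finset.mem_singleton_self m))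
  have key : ∀ p ∈ f, (p.1 < a ∧ p.2 < b) ∨ (a < p.1 ∧ b < p.2) := by
    intro p hp
    rcases lt_trichotomy p.1 a with hpa | rfl | hpa
    · exact .inl ⟨hpa, (hm₁ _ (Finset.mem_image_of_mem _ (Finset.mem_filter.2 ⟨hp, hpa⟩))).trans hmb⟩
    · exact absurd ⟨p.2, hp⟩ h
    · exact .inr ⟨hpa, hbm.trans
        (hm'₂ _ (Finset.mem_image_of_mem _ (Finset.mem_filter.2 ⟨hp, hpa⟩)))⟩
  refine ⟨b, ?_, ?_⟩
  · intro p hp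
    rcases Finset.mem_insert.1 hp with rfl | hp
    exacts [hab, hf.1 p hp]
  · intro p hp q hq
    rcases Finset.mem_insert.1 hp with rfl | hp <;> rcases Finset.mem_insert.1 hq with rfl | hq
    · simp
    · rcases key q hq with h | h
      · exact iff_of_false h.1.not_gt h.2.not_gt
      · exact iff_of_true h.1 h.2
    · rcases key p hp with h | h
      · exact iff_of_true h.1 h.2
      · exact iff_of_false h.1.not_gt h.2.not_gt
    · exact hf.2 p hp q hq

theorem IsPartialIso.swap {r : α → β → Prop} {f : Finset (α × β)} (hf : IsPartialIso r f) :
    IsPartialIso (flip r) (f.image Prod.swap) := by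
  constructor
  · intro p hp
    obtain ⟨p', hp', rfl⟩ := Finset.mem_image.1 hp
    exact hf.1 p' hp'
  · intro p hp q hq
    obtain ⟨p', hp', rfl⟩ := Finset.mem_image.1 hp
    obtain ⟨q', hq', rfl⟩ := Finset.mem_image.1 hq
    exact (hf.2 p' hp' q' hq').symm

theorem IsPartialIso.exists_insert_right [DenselyOrdered α] [NoMinOrder α] [NoMaxOrder α]
    [Nonempty α] {r : α → β → Prop} (hr : ∀ (b : β) (x y : α), x < y → ∃ a, x < a ∧ a < y ∧ r a b)
    {f : Finset (α × β)} (hf : IsPartialIso r f) (b : β) :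
    ∃ a, IsPartialIso r (insert (a, b) f) := by
  obtain ⟨a, ha⟩ := hf.swap.exists_insert_left hr b
  have := ha.swap
  rw [Finset.image_insert, Finset.image_image, Prod.swap_swap_eq, Finset.image_id] at this
  exact ⟨a, this⟩

/-- **Cantor's theorem along a relation**: if every point of either order has `r`-partners in every
interval of the other, then some isomorphism pairs only `r`-related points. For the relation of
having the same colour this is Skolem's theorem on dense colourings. -/
theorem exists_orderIso_of_dense_rel [Countable α] [DenselyOrdered α] [NoMinOrder α] [NoMaxOrder α]
    [Nonempty α] [Countable β] [DenselyOrdered β] [NoMinOrder β] [NoMaxOrder β] [Nonempty β]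
    (r : α → β → Prop) (h₁ : ∀ (a : α) (x y : β), x < y → ∃ b, x < b ∧ b < y ∧ r a b)
    (h₂ : ∀ (b : β) (x y : α), x < y → ∃ a, x < a ∧ a < y ∧ r a b) :
    ∃ e : α ≃o β, ∀ a, r a (e a) := by
  cases nonempty_encodable α
  cases nonempty_encodable β
  let left (a : α) : Order.Cofinal {f : Finset (α × β) // IsPartialIso r f} :=
    { carrier := {f | ∃ b, (a, b) ∈ f.1}
      isCofinal := fun f => by
        obtain ⟨b, hb⟩ := f.2.exists_insert_left h₁ a
        exact ⟨⟨_, hb⟩, ⟨b, Finset.mem_insert_self _ _⟩, Finset.subset_insert _ _⟩ }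
  let right (b : β) : Order.Cofinal {f : Finset (α × β) // IsPartialIso r f} :=
    { carrier := {f | ∃ a, (a, b) ∈ f.1}
      isCofinal := fun f => by
        obtain ⟨a, ha⟩ := f.2.exists_insert_right h₂ b
        exact ⟨⟨_, ha⟩, ⟨a, Finset.mem_insert_self _ _⟩, Finset.subset_insert _ _⟩ }
  let D : α ⊕ β → Order.Cofinal {f : Finset (α × β) // IsPartialIso r f} := Sum.elim left right
  let J := Order.idealOfCofinals ⟨∅, by simp [IsPartialIso]⟩ D
  have hF : ∀ a, ∃ b, ∃ f ∈ J, (a, b) ∈ f.1 := fun a => by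
    obtain ⟨f, ⟨b, hb⟩, hf⟩ :=
      Order.cofinal_meets_idealOfCofinals ⟨∅, by simp [IsPartialIso]⟩ D (.inl a)
    exact ⟨b, f, hf, hb⟩
  have hG : ∀ b, ∃ a, ∃ f ∈ J, (a, b) ∈ f.1 := fun b => by
    obtain ⟨f, ⟨a, ha⟩, hf⟩ :=
      Order.cofinal_meets_idealOfCofinals ⟨∅, by simp [IsPartialIso]⟩ D (.inr b)
    exact ⟨a, f, hf, ha⟩
  have hlt : ∀ {a a' b b'}, (∃ f ∈ J, (a, b) ∈ f.1) → (∃ f ∈ J, (a', b') ∈ f.1) →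
      (a < a' ↔ b < b') := by
    rintro a a' b b' ⟨f, hf, hab⟩ ⟨g, hg, hab'⟩
    obtain ⟨m, -, hfm, hgm⟩ := J.directed _ hf _ hg
    exact m.2.2 _ (hfm hab) _ (hgm hab')
  choose F hF using hF
  have hmono : StrictMono F := fun a a' h => (hlt (hF a) (hF a')).1 h
  refine ⟨hmono.orderIsoOfSurjective F fun b => ?_, fun a => ?_⟩
  · obtain ⟨a, ha⟩ := hG b
    refine ⟨a, le_antisymm ?_ ?_⟩
    · exact not_lt.1 fun h => lt_irrefl _ ((hlt ha (hF a)).2 h)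
    · exact not_lt.1 fun h => lt_irrefl _ ((hlt (hF a) ha).2 h)
  · obtain ⟨f, -, hf⟩ := hF a
    exact f.2.1 _ hf

end BackAndForth

/-! ### Lexicographic sums -/

section Lex

theorem sigmaLex_ordIso {α β : Type*} [LinearOrder α] [LinearOrder β] {J : α → Type*}
    {J' : β → Type*} [∀ a, LinearOrder (J a)] [∀ b, LinearOrder (J' b)] (e : α ≃o β)
    (h : ∀ a, J a ≅ₒ J' (e a)) : (Σₗ a, J a) ≅ₒ (Σₗ b, J' b) := by
  let φ : ∀ a, J a ≃o J' (e a) := fun a => Nonempty.some (h a)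
  refine StrictMono.ordIso (g := fun x : Σₗ a, J a =>
    (toLex ⟨e (ofLex x).1, φ _ (ofLex x).2⟩ : Σₗ b, J' b)) ?_ ?_
  · rintro ⟨a, x⟩ ⟨b, y⟩ hxy
    rcases hxy with ⟨_, _, hab⟩ | ⟨_, _, hxy⟩
    · exact Sigma.Lex.left _ _ (e.strictMono hab)
    · exact Sigma.Lex.right _ _ ((φ a).strictMono hxy)
  · rintro ⟨b, y⟩
    obtain ⟨a, rfl⟩ := e.surjective b
    obtain ⟨x, rfl⟩ := (φ a).surjective y
    exact ⟨toLex ⟨a, x⟩, rfl⟩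

/-- Two countable lexicographic sums over dense orders without endpoints are isomorphic if every
summand of either sum is isomorphic to summands in every interval of the other. -/
theorem sigmaLex_ordIso_of_dense {α β : Type*} [LinearOrder α] [LinearOrder β] {J : α → Type*}
    {J' : β → Type*} [∀ a, LinearOrder (J a)] [∀ b, LinearOrder (J' b)]
    [Countable α] [DenselyOrdered α] [NoMinOrder α] [NoMaxOrder α]
    [Nonempty α] [Countable β] [DenselyOrdered β] [NoMinOrder β] [NoMaxOrder β] [Nonempty β]
    (h₁ : ∀ (a : α) (x y : β), x < y → ∃ b, x < b ∧ b < y ∧ J a ≅ₒ J' b)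
    (h₂ : ∀ (b : β) (x y : α), x < y → ∃ a, x < a ∧ a < y ∧ J a ≅ₒ J' b) :
    (Σₗ a, J a) ≅ₒ (Σₗ b, J' b) :=
  let ⟨e, he⟩ := exists_orderIso_of_dense_rel (fun a b => J a ≅ₒ J' b) h₁ h₂
  sigmaLex_ordIso e he

theorem sumLex_ordIso {Y U M V : Type*} [LinearOrder Y] [LinearOrder U] [LinearOrder M]
    [LinearOrder V] {f : U → Y} {g : M → Y} {h : V → Y} (hf : StrictMono f) (hg : StrictMono g)
    (hh : StrictMono h) (hfg : ∀ x y, f x < g y) (hgh : ∀ x y, g x < h y) (hfh : ∀ x y, f x < h y)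
    (hsurj : ∀ y, (∃ x, f x = y) ∨ (∃ x, g x = y) ∨ ∃ x, h x = y) :
    Y ≅ₒ (U ⊕ₗ (M ⊕ₗ V)) := by
  refine OrdIso.symm (StrictMono.ordIso (g := fun x : U ⊕ₗ (M ⊕ₗ V) =>
    Sum.elim f (fun y : M ⊕ₗ V => Sum.elim g h (ofLex y)) (ofLex x)) ?_ ?_)
  · rintro (a | a | a) (b | b | b) hab
    · exact hf (Sum.Lex.inl_lt_inl_iff.1 hab)
    · exact hfg _ _
    · exact hfh _ _
    · exact absurd hab Sum.Lex.not_inr_lt_inl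
    · exact hg (Sum.Lex.inl_lt_inl_iff.1 (Sum.Lex.inr_lt_inr_iff.1 hab))
    · exact hgh _ _
    · exact absurd hab Sum.Lex.not_inr_lt_inl
    · exact absurd (Sum.Lex.inr_lt_inr_iff.1 hab) Sum.Lex.not_inr_lt_inl
    · exact hh (Sum.Lex.inr_lt_inr_iff.1 (Sum.Lex.inr_lt_inr_iff.1 hab))
  · intro y
    rcases hsurj y with ⟨x, rfl⟩ | ⟨x, rfl⟩ | ⟨x, rfl⟩
    · exact ⟨toLex (.inl x), rfl⟩
    · exact ⟨toLex (.inr (toLex (.inl x))), rfl⟩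
    · exact ⟨toLex (.inr (toLex (.inr x))), rfl⟩

theorem OrdIso.prodLex {A B X Y : Type*} [LinearOrder A] [LinearOrder B] [LinearOrder X]
    [LinearOrder Y] (h₁ : A ≅ₒ B) (h₂ : X ≅ₒ Y) : (A ×ₗ X) ≅ₒ (B ×ₗ Y) := by
  obtain ⟨e⟩ := h₁
  obtain ⟨e'⟩ := h₂
  refine StrictMono.ordIso (g := fun x : A ×ₗ X => toLex (e (ofLex x).1, e' (ofLex x).2)) ?_ ?_
  · rintro ⟨a, x⟩ ⟨b, y⟩ hxy
    rcases hxy with ⟨_, _, hab⟩ | ⟨_, hxy⟩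
    · exact Prod.Lex.left _ _ (e.strictMono hab)
    · exact Prod.Lex.right _ (e'.strictMono hxy)
  · rintro ⟨b, y⟩
    exact ⟨toLex (e.symm b, e'.symm y), by simp; rfl⟩

theorem OrdIso.unit_prodLex (X : Type*) [LinearOrder X] : (PUnit.{u + 1} ×ₗ X) ≅ₒ X := by
  refine StrictMono.ordIso (g := fun x : PUnit.{u + 1} ×ₗ X => (ofLex x).2) ?_
    fun x => ⟨toLex (⟨⟩, x), rfl⟩
  rintro ⟨a, x⟩ ⟨b, y⟩ hxy
  rcases hxy with ⟨_, _, hab⟩ | ⟨_, hxy⟩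
  · exact absurd hab (lt_irrefl _)
  · exact hxy

theorem LeftAbsorbs.congr {X Y A : Type u} [LinearOrder X] [LinearOrder Y] [LinearOrder A]
    (h : X ≅ₒ Y) : LeftAbsorbs X A ↔ LeftAbsorbs Y A := by
  have hA : A ≅ₒ A := ⟨OrderIso.refl A⟩
  exact ⟨fun h' => ((hA.prodLex h.symm).trans h').trans h,
    fun h' => ((hA.prodLex h).trans h').trans h.symm⟩

theorem convexEmb_prodLex_mk {A X : Type*} [LinearOrder A] [LinearOrder X] (a : A) :
    ConvexEmb (fun x : X => toLex (a, x)) where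
  strictMono _ _ h := Prod.Lex.right _ h
  exists_eq := by
    rintro x y ⟨b, z⟩ h₁ h₂
    have hab : a ≤ b := Prod.Lex.monotone_fst _ _ h₁
    have hba : b ≤ a := Prod.Lex.monotone_fst _ _ h₂
    obtain rfl := le_antisymm hab hba
    exact ⟨z, rfl⟩

theorem convexEmb_sigmaLex_mk {ι : Type*} [LinearOrder ι] {J : ι → Type*} [∀ i, LinearOrder (J i)]
    (i : ι) : ConvexEmb (fun x : J i => (toLex ⟨i, x⟩ : Σₗ i, J i)) where
  strictMono _ _ h := Sigma.Lex.right _ _ h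
  exists_eq := by
    rintro x y ⟨j, w⟩ h₁ h₂
    rcases h₁ with ⟨_, _, h₁⟩ | ⟨_, v, h₁⟩
    · rcases h₂ with ⟨_, _, h₂⟩ | ⟨_, _, h₂⟩
      · exact absurd h₁ h₂.not_gt
      · exact absurd h₁ (lt_irrefl _)
    · exact ⟨v, rfl⟩

theorem convexEmb_sumLex_inl (X Y : Type*) [LinearOrder X] [LinearOrder Y] :
    ConvexEmb (fun x : X => (toLex (Sum.inl x) : X ⊕ₗ Y)) where
  strictMono := Sum.Lex.inl_strictMono
  exists_eq := by
    rintro x y (z | z) h₁ h₂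
    · exact ⟨z, rfl⟩
    · exact absurd h₂ Sum.Lex.not_inr_le_inl

theorem convexEmb_sumLex_inr (X Y : Type*) [LinearOrder X] [LinearOrder Y] :
    ConvexEmb (fun x : Y => (toLex (Sum.inr x) : X ⊕ₗ Y)) where
  strictMono := Sum.Lex.inr_strictMono
  exists_eq := by
    rintro x y (z | z) h₁ h₂
    · exact absurd h₁ Sum.Lex.not_inr_le_inl
    · exact ⟨z, rfl⟩

end Lex

/-! ### Orders as sums of their blocks -/

section Blocks

variable {P Z : Type*} [LinearOrder P] [LinearOrder Z]

/-- A convex set without least and greatest block is the sum of its blocks over a dense order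
without endpoints, which is realized by representatives of the blocks. -/
theorem exists_ordIso_sigma_block (hP : SelfDoubling P) {M : Set Z} (hM : M.OrdConnected)
    (hlo : ∀ x ∈ M, ∃ y ∈ M, y < x ∧ ¬ Close P y x)
    (hhi : ∀ x ∈ M, ∃ y ∈ M, x < y ∧ ¬ Close P x y) :
    ∃ D : Set Z, D ⊆ M ∧ (∀ d ∈ D, ∀ d' ∈ D, Close P d d' → d = d') ∧
      (∀ x ∈ M, ∃ d ∈ D, Close P x d) ∧ DenselyOrdered D ∧ NoMinOrder D ∧ NoMaxOrder D ∧
      M ≅ₒ (Σₗ d : D, block P d.1) := by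
  let s : Setoid Z := ⟨Close P, close_refl hP, Close.symm, Close.trans hP⟩
  let rep : Z → Z := fun x => (Quotient.mk s x).out
  have hrep : ∀ x, Close P (rep x) x := fun x => Quotient.exact (s := s) (Quotient.out_eq _)
  have hrep' : ∀ {x y}, Close P x y → rep x = rep y := fun h =>
    congrArg Quotient.out (Quotient.sound (s := s) h)
  -- convexity of the blocks makes the choice of representatives monotone
  have hlt : ∀ {x y}, x < y → ¬ Close P x y → rep x < rep y := by
    intro x y hxy h
    by_contra! hle
    have hx : Close P (rep x) x := hrep x
    have hy : Close P (rep y) y := hrep y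
    rcases le_total (rep y) x with h₁ | h₁
    · exact h ((hy.symm.of_mem (by rw [mem_uIcc]; exact .inr ⟨h₁, hxy.le⟩) left_mem_uIcc))
    · exact h (((hx.symm.of_mem left_mem_uIcc (Icc_subset_uIcc ⟨h₁, hle⟩)).trans hP hy))
  have hmem : ∀ {x y}, x ∈ M → Close P x y → y ∈ M := by
    intro x y hx hxy
    obtain ⟨w, hw, hwx, hcw⟩ := hlo x hx
    obtain ⟨z, hz, hxz, hcz⟩ := hhi x hx
    refine hM.out hw hz ⟨?_, ?_⟩
    · by_contra! h
      exact hcw (hxy.of_mem (by rw [mem_uIcc]; exact .inr ⟨h.le, hwx.le⟩) left_mem_uIcc)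
    · by_contra! h
      exact hcz (hxy.of_mem left_mem_uIcc (by rw [mem_uIcc]; exact .inl ⟨hxz.le, h.le⟩))
  let D : Set Z := {x | x ∈ M ∧ rep x = x}
  have hD : ∀ {x}, x ∈ M → rep x ∈ D := fun {x} hx => ⟨hmem hx (hrep x).symm, hrep' (hrep x)⟩
  have hne : ∀ {d d' : D}, d < d' → ¬ Close P d.1 d'.1 := fun {d d'} h h' =>
    h.ne (Subtype.ext (by rw [← d.2.2, ← d'.2.2]; exact hrep' h'))
  refine ⟨D, fun _ h => h.1, fun d hd d' hd' h => by rw [← hd.2, ← hd'.2, hrep' h],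
    fun x hx => ⟨_, hD hx, (hrep x).symm⟩, ⟨fun d d' h => ?_⟩, ⟨fun d => ?_⟩, ⟨fun d => ?_⟩, ?_⟩
  · obtain ⟨z, h₁, h₂, h₃, h₄⟩ := exists_between_not_close hP (show d.1 < d'.1 from h) (hne h)
    refine ⟨⟨rep z, hD (hM.out d.2.1 d'.2.1 ⟨h₁.le, h₂.le⟩)⟩, ?_, ?_⟩
    · have := hlt h₁ h₃; rwa [d.2.2] at this
    · have := hlt h₂ h₄; rwa [d'.2.2] at this
  · obtain ⟨y, hy, hyd, h⟩ := hlo d d.2.1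
    have := hlt hyd h; rw [d.2.2] at this
    exact ⟨⟨rep y, hD hy⟩, this⟩
  · obtain ⟨y, hy, hyd, h⟩ := hhi d d.2.1
    have := hlt hyd h; rw [d.2.2] at this
    exact ⟨⟨rep y, hD hy⟩, this⟩
  · refine OrdIso.symm (StrictMono.ordIso (g := fun x : Σₗ d : D, block P d.1 =>
      (⟨(ofLex x).2.1, hmem (ofLex x).1.2.1 (ofLex x).2.2⟩ : M)) ?_ ?_)
    · rintro ⟨d, x⟩ ⟨d', x'⟩ h
      rcases h with ⟨_, _, h⟩ | ⟨_, _, h⟩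
      · change x.1 < x'.1
        by_contra! hle
        have hx : Close P d.1 x.1 := x.2
        have hx' : Close P d'.1 x'.1 := x'.2
        rcases le_total x'.1 d.1 with h₁ | h₁
        · exact hne h (hx'.symm.of_mem (by rw [mem_uIcc]; exact .inl ⟨h₁, h.le⟩) right_mem_uIcc)
        · exact hne h ((hx.of_mem left_mem_uIcc (Icc_subset_uIcc ⟨h₁, hle⟩)).trans hP hx'.symm)
      · exact h
    · rintro ⟨x, hx⟩
      exact ⟨toLex ⟨⟨rep x, hD hx⟩, ⟨x, hrep x⟩⟩, rfl⟩

theorem IsDensePartition.exists_between {K : Type} {c : ℚ → K} (hc : IsDensePartition c) (k : K)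
    {x y : ℚ} (h : x < y) : ∃ q, x < q ∧ q < y ∧ c q = k :=
  let ⟨q, hq, hxy⟩ := (hc k).exists_between h; ⟨q, hxy.1, hxy.2, hq⟩

/-- Recognition of a shuffle: the blocks are members of the collection, and each member occurs
between any two blocks. -/
theorem ordIso_shuffle_of_blocks [Countable Z] (hP : SelfDoubling P) {M : Set Z}
    (hM : M.OrdConnected) (hne : M.Nonempty)
    (hlo : ∀ x ∈ M, ∃ y ∈ M, y < x ∧ ¬ Close P y x)
    (hhi : ∀ x ∈ M, ∃ y ∈ M, x < y ∧ ¬ Close P x y)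
    {K : Type} {I : K → Type*} [∀ k, LinearOrder (I k)] {c : ℚ → K} (hc : IsDensePartition c)
    (hI : ∀ x ∈ M, ∃ k, block P x ≅ₒ I k)
    (hdense : ∀ x ∈ M, ∀ y ∈ M, x < y → ¬ Close P x y → ∀ k,
      ∃ z, x < z ∧ z < y ∧ ¬ Close P x z ∧ ¬ Close P z y ∧ block P z ≅ₒ I k) :
    M ≅ₒ Shuffle I c := by
  obtain ⟨D, hDM, hD, hMD, _, _, _, hiso⟩ := exists_ordIso_sigma_block hP hM hlo hhi
  obtain ⟨x, hx⟩ := hne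
  obtain ⟨d, hd, -⟩ := hMD x hx
  have : Nonempty D := ⟨⟨d, hd⟩⟩
  refine hiso.trans (sigmaLex_ordIso_of_dense (fun d x y hxy => ?_) fun q x y hxy => ?_)
  · obtain ⟨k, hk⟩ := hI d (hDM d.2)
    obtain ⟨q, h₁, h₂, rfl⟩ := hc.exists_between k hxy
    exact ⟨q, h₁, h₂, hk⟩
  · obtain ⟨z, h₁, h₂, h₃, h₄, hz⟩ := hdense x (hDM x.2) y (hDM y.2) hxy
      (fun h => hxy.ne (Subtype.ext (hD _ x.2 _ y.2 h))) (c q)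
    obtain ⟨d, hd, hzd⟩ := hMD z (hM.out (hDM x.2) (hDM y.2) ⟨h₁.le, h₂.le⟩)
    refine ⟨⟨d, hd⟩, ?_, ?_, ?_⟩
    · change x.1 < d
      by_contra! h
      exact h₃ (hzd.of_mem (by rw [mem_uIcc]; exact .inr ⟨h, h₁.le⟩) left_mem_uIcc)
    · change d < y.1
      by_contra! h
      exact h₄ (hzd.of_mem left_mem_uIcc (by rw [mem_uIcc]; exact .inl ⟨h₂.le, h⟩))
    · have := block_eq hP hzd
      rwa [this] at hz

end Blocks

/-! ### Inner points -/

section Inner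

variable {P Z : Type*} [LinearOrder P] [LinearOrder Z]

theorem ordConnected_setOf_isInner : {x : Z | IsInner P x}.OrdConnected := by
  refine ⟨fun x hx y hy z hz => ?_⟩
  obtain ⟨⟨w, hwx, hw⟩, -⟩ := hx
  obtain ⟨-, ⟨v, hyv, hv⟩⟩ := hy
  exact ⟨⟨w, hwx.trans_le hz.1, not_close_mono hw le_rfl hwx.le hz.1⟩,
    v, hz.2.trans_lt hyv, not_close_mono hv hz.2 hyv.le le_rfl⟩

theorem IsInner.exists_lt (hP : SelfDoubling P) {x : Z} (hx : IsInner P x) :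
    ∃ y, IsInner P y ∧ y < x ∧ ¬ Close P y x := by
  obtain ⟨w, hwx, hw⟩ := hx.1
  obtain ⟨z, h₁, h₂, h₃, h₄⟩ := exists_between_not_close hP hwx hw
  exact ⟨z, ⟨⟨w, h₁, h₃⟩, x, h₂, h₄⟩, h₂, h₄⟩

theorem IsInner.exists_gt (hP : SelfDoubling P) {x : Z} (hx : IsInner P x) :
    ∃ y, IsInner P y ∧ x < y ∧ ¬ Close P x y := by
  obtain ⟨w, hwx, hw⟩ := hx.2
  obtain ⟨z, h₁, h₂, h₃, h₄⟩ := exists_between_not_close hP hwx hw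
  exact ⟨z, ⟨⟨x, h₁, h₃⟩, w, h₂, h₄⟩, h₁, h₃⟩

end Inner

/-! ### The blocks of a shuffle -/

section Shuffle

variable {K : Type} {I : K → Type u} [∀ k, LinearOrder (I k)] {c : ℚ → K}

/-- By Skolem's theorem every interval of the index set `ℚ` carries a copy of the whole shuffle. -/
theorem exists_convexEmb_shuffle (hc : IsDensePartition c) {q q' : ℚ} (h : q < q') :
    ∃ g : Shuffle I c → Shuffle I c,
      ConvexEmb g ∧ ∀ s, q < (ofLex (g s)).1 ∧ (ofLex (g s)).1 < q' := by
  have : Nonempty (Ioo q q') := nonempty_Ioo_subtype h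
  obtain ⟨e⟩ : Shuffle I c ≅ₒ (Σₗ r : Ioo q q', I (c r)) := by
    refine sigmaLex_ordIso_of_dense (fun a x y hxy => ?_) (fun b x y hxy => ?_)
    · obtain ⟨r, h₁, h₂, hr⟩ := hc.exists_between (c a) (show x.1 < y.1 from hxy)
      refine ⟨⟨r, x.2.1.trans h₁, h₂.trans y.2.2⟩, h₁, h₂, ?_⟩
      rw [hr]
      exact ⟨OrderIso.refl _⟩
    · obtain ⟨r, h₁, h₂, hr⟩ := hc.exists_between (c b) hxy
      refine ⟨r, h₁, h₂, ?_⟩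
      rw [hr]
      exact ⟨OrderIso.refl _⟩
  refine ⟨(fun x : Σₗ r : Ioo q q', I (c r) =>
    (toLex ⟨(ofLex x).1.1, (ofLex x).2⟩ : Shuffle I c)) ∘ e, ConvexEmb.comp ⟨?_, ?_⟩ e.convexEmb,
    fun s => (ofLex (e s)).1.2⟩
  · rintro ⟨a, x⟩ ⟨b, y⟩ hxy
    rcases hxy with ⟨_, _, hab⟩ | ⟨_, _, hxy⟩
    · exact Sigma.Lex.left _ _ hab
    · exact Sigma.Lex.right _ _ hxy
  · rintro ⟨a, x⟩ ⟨b, y⟩ ⟨r, z⟩ h₁ h₂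
    have h₁' : a.1 ≤ r := by
      rcases h₁ with ⟨_, _, h⟩ | _
      exacts [h.le, le_rfl]
    have h₂' : r ≤ b.1 := by
      rcases h₂ with ⟨_, _, h⟩ | _
      exacts [h.le, le_rfl]
    exact ⟨toLex ⟨⟨r, a.2.1.trans_le h₁', h₂'.trans_lt b.2.2⟩, z⟩, rfl⟩

theorem IsMinimalCollection.selfDoubling (hI : IsMinimalCollection I c) :
    SelfDoubling (Shuffle I c) := by
  obtain ⟨i⟩ := hI.nonempty (c 0)
  obtain ⟨f, hf, hf'⟩ := exists_convexEmb_shuffle (I := I) hI.dense (zero_lt_one' ℚ)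
  obtain ⟨g, hg, hg'⟩ := exists_convexEmb_shuffle (I := I) hI.dense (one_lt_two : (1 : ℚ) < 2)
  exact ⟨⟨toLex ⟨0, i⟩⟩, f, g, hf, hg, fun x y =>
    Sigma.Lex.lt_def.2 (.inl ((hf' x).2.trans (hg' y).1))⟩

theorem not_hasCopy_range {P Y Z : Type*} [LinearOrder P] [LinearOrder Y] [LinearOrder Z]
    {e : Y → Z} (he : ConvexEmb e) (h : ¬ HasCopy P (univ : Set Y)) : ¬ HasCopy P (range e) :=
  fun h' => h ((h'.preimage he subset_rfl).mono (subset_univ _))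

theorem IsMinimalCollection.not_hasCopy (hI : IsMinimalCollection I c) (k : K) :
    ¬ HasCopy (Shuffle I c) (univ : Set (I k)) :=
  fun h => hI.minimal k (containsConvexCopy_iff.2 h)

theorem IsMinimalCollection.not_close (hI : IsMinimalCollection I c) {s t : Shuffle I c}
    (h : (ofLex s).1 < (ofLex t).1) : ¬ Close (Shuffle I c) s t := by
  intro hc
  obtain ⟨g, hg, hg'⟩ := exists_convexEmb_shuffle (I := I) hI.dense h
  refine hc ⟨g, hg, fun p => Icc_subset_uIcc ⟨?_, ?_⟩⟩
  · exact (Sigma.Lex.lt_def.2 (.inl (hg' p).1)).le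
  · exact (Sigma.Lex.lt_def.2 (.inl (hg' p).2)).le

/-- The blocks of a minimal shuffle with respect to itself are the summands: minimality keeps a
summand inside one block. -/
theorem IsMinimalCollection.block_shuffle (hI : IsMinimalCollection I c) (s : Shuffle I c) :
    block (Shuffle I c) s =
      range fun i : I (c (ofLex s).1) => (toLex ⟨(ofLex s).1, i⟩ : Shuffle I c) := by
  have he := convexEmb_sigmaLex_mk (J := fun q => I (c q)) (ofLex s).1
  refine block_eq_of_forall he.ordConnected_range (not_hasCopy_range he (hI.not_hasCopy _))
    ⟨(ofLex s).2, rfl⟩ fun t ht => ?_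
  rcases lt_trichotomy (ofLex s).1 (ofLex t).1 with h | h | h
  · exact hI.not_close h
  · refine absurd ?_ ht
    obtain ⟨q, i⟩ := s
    obtain ⟨q', j⟩ := t
    obtain rfl : q = q' := h
    exact ⟨j, rfl⟩
  · rw [close_comm]
    exact hI.not_close h

theorem IsMinimalCollection.block_shuffle_ordIso (hI : IsMinimalCollection I c)
    (s : Shuffle I c) : block (Shuffle I c) s ≅ₒ I (c (ofLex s).1) := by
  rw [hI.block_shuffle]
  exact (convexEmb_sigmaLex_mk (J := fun q => I (c q)) (ofLex s).1).strictMono.ordIso_range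

theorem IsMinimalCollection.exists_fst_eq (hI : IsMinimalCollection I c) (q : ℚ) :
    ∃ s : Shuffle I c, (ofLex s).1 = q :=
  let ⟨i⟩ := hI.nonempty (c q); ⟨toLex ⟨q, i⟩, rfl⟩

theorem IsMinimalCollection.exists_lt_not_close (hI : IsMinimalCollection I c) (s : Shuffle I c) :
    ∃ t, t < s ∧ ¬ Close (Shuffle I c) t s := by
  obtain ⟨t, ht⟩ := hI.exists_fst_eq ((ofLex s).1 - 1)
  have h : (ofLex t).1 < (ofLex s).1 := by rw [ht]; linarith
  exact ⟨t, Sigma.Lex.lt_def.2 (.inl h), hI.not_close h⟩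

theorem IsMinimalCollection.exists_gt_not_close (hI : IsMinimalCollection I c) (s : Shuffle I c) :
    ∃ t, s < t ∧ ¬ Close (Shuffle I c) s t := by
  obtain ⟨t, ht⟩ := hI.exists_fst_eq ((ofLex s).1 + 1)
  have h : (ofLex s).1 < (ofLex t).1 := by rw [ht]; linarith
  exact ⟨t, Sigma.Lex.lt_def.2 (.inl h), hI.not_close h⟩

theorem IsMinimalCollection.isInner_shuffle (hI : IsMinimalCollection I c) (s : Shuffle I c) :
    IsInner (Shuffle I c) s :=
  ⟨hI.exists_lt_not_close s, hI.exists_gt_not_close s⟩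

/-- Between any two blocks with respect to the shuffle of a minimal collection, every member of the
collection occurs as a block, since a whole copy of the shuffle lies there. -/
theorem IsMinimalCollection.exists_block_ordIso (hI : IsMinimalCollection I c) {Z : Type*}
    [LinearOrder Z] {x y : Z} (hxy : x < y) (h : ¬ Close (Shuffle I c) x y) (k : K) :
    ∃ z, x < z ∧ z < y ∧ ¬ Close (Shuffle I c) x z ∧ ¬ Close (Shuffle I c) z y ∧
      block (Shuffle I c) z ≅ₒ I k := by
  obtain ⟨g, hg, hgxy⟩ := not_not.1 h
  rw [uIcc_of_le hxy.le] at hgxy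
  obtain ⟨q, -, -, rfl⟩ := hI.dense.exists_between k (zero_lt_one' ℚ)
  obtain ⟨s, rfl⟩ := hI.exists_fst_eq q
  obtain ⟨t, hts, ht⟩ := hI.exists_lt_not_close s
  obtain ⟨t', hst', ht'⟩ := hI.exists_gt_not_close s
  have h₁ := hg.strictMono hts
  have h₂ := hg.strictMono hst'
  refine ⟨g s, (hgxy t).1.trans_lt h₁, h₂.trans_le (hgxy t').2, ?_, ?_,
    (hg.block_ordIso (hI.isInner_shuffle s)).trans (hI.block_shuffle_ordIso s)⟩
  · exact not_close_mono (mt hg.close_iff.1 ht) (hgxy t).1 h₁.le le_rfl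
  · exact not_close_mono (mt hg.close_iff.1 ht') le_rfl h₂.le (hgxy t').2

end Shuffle

/-! ### The blocks of a product `A (L + ℚ[I_k] + R)` -/

section Product

/-- The point of the copy of `L` with index `a` in `A (L + S + R)`. -/
def leftPt {A L S R : Type*} (a : A) (l : L) : A ×ₗ (L ⊕ₗ (S ⊕ₗ R)) :=
  toLex (a, toLex (Sum.inl l))

/-- The point of the copy of `S` with index `a` in `A (L + S + R)`. -/
def midPt {A L S R : Type*} (a : A) (s : S) : A ×ₗ (L ⊕ₗ (S ⊕ₗ R)) :=
  toLex (a, toLex (Sum.inr (toLex (Sum.inl s))))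

/-- The point of the copy of `R` with index `a` in `A (L + S + R)`. -/
def rightPt {A L S R : Type*} (a : A) (r : R) : A ×ₗ (L ⊕ₗ (S ⊕ₗ R)) :=
  toLex (a, toLex (Sum.inr (toLex (Sum.inr r))))

theorem prod_sum_cases {A L S R : Type*} (z : A ×ₗ (L ⊕ₗ (S ⊕ₗ R))) :
    (∃ a l, z = leftPt a l) ∨ (∃ a s, z = midPt a s) ∨ ∃ a r, z = rightPt a r := by
  rcases z with ⟨a, l | s | r⟩
  · exact .inl ⟨a, l, rfl⟩
  · exact .inr (.inl ⟨a, s, rfl⟩)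
  · exact .inr (.inr ⟨a, r, rfl⟩)

variable {A L S R : Type*} [LinearOrder A] [LinearOrder L] [LinearOrder S] [LinearOrder R]

theorem prodLex_lt_of_fst_lt {X : Type*} [LinearOrder X] {y z : A ×ₗ X}
    (h : (ofLex y).1 < (ofLex z).1) : y < z :=
  Prod.Lex.lt_iff.2 (.inl h)

theorem leftPt_lt_midPt (a : A) (l : L) (s : S) :
    (leftPt a l : A ×ₗ (L ⊕ₗ (S ⊕ₗ R))) < midPt a s :=
  Prod.Lex.right _ (Sum.Lex.inl_lt_inr _ _)

theorem midPt_lt_rightPt (a : A) (s : S) (r : R) :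
    (midPt a s : A ×ₗ (L ⊕ₗ (S ⊕ₗ R))) < rightPt a r :=
  Prod.Lex.right _ (Sum.Lex.inr_strictMono (Sum.Lex.inl_lt_inr _ _))

theorem leftPt_lt_rightPt (a : A) (l : L) (r : R) :
    (leftPt a l : A ×ₗ (L ⊕ₗ (S ⊕ₗ R))) < rightPt a r :=
  Prod.Lex.right _ (Sum.Lex.inl_lt_inr _ _)

theorem convexEmb_leftPt (a : A) :
    ConvexEmb (leftPt a : L → A ×ₗ (L ⊕ₗ (S ⊕ₗ R))) :=
  (convexEmb_prodLex_mk a).comp (convexEmb_sumLex_inl _ _)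

theorem convexEmb_midPt (a : A) :
    ConvexEmb (midPt a : S → A ×ₗ (L ⊕ₗ (S ⊕ₗ R))) :=
  (convexEmb_prodLex_mk a).comp ((convexEmb_sumLex_inr _ _).comp (convexEmb_sumLex_inl _ _))

theorem convexEmb_rightPt (a : A) :
    ConvexEmb (rightPt a : R → A ×ₗ (L ⊕ₗ (S ⊕ₗ R))) :=
  (convexEmb_prodLex_mk a).comp ((convexEmb_sumLex_inr _ _).comp (convexEmb_sumLex_inr _ _))

/-- The copy of `R + L` formed by the copies of `R` with index `a` and of `L` with index `b` in
`A (L + S + R)`; it is convex if `b` is the successor of `a`. -/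
def gapPt (a b : A) (x : R ⊕ₗ L) : A ×ₗ (L ⊕ₗ (S ⊕ₗ R)) :=
  Sum.elim (rightPt a) (leftPt b) (ofLex x)

theorem convexEmb_gapPt {a b : A} (hab : a ⋖ b) :
    ConvexEmb (gapPt a b : R ⊕ₗ L → A ×ₗ (L ⊕ₗ (S ⊕ₗ R))) where
  strictMono := by
    rintro (x | x) (y | y) hxy
    · exact (convexEmb_rightPt a).strictMono (Sum.Lex.inl_lt_inl_iff.1 hxy)
    · exact prodLex_lt_of_fst_lt hab.lt
    · exact absurd hxy Sum.Lex.not_inr_lt_inl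
    · exact (convexEmb_leftPt b).strictMono (Sum.Lex.inr_lt_inr_iff.1 hxy)
  exists_eq := by
    rintro x y z hx hy
    have hz₁ : a ≤ (ofLex z).1 := by
      refine le_trans ?_ (Prod.Lex.monotone_fst _ _ hx)
      rcases x with x | x
      exacts [le_rfl, hab.le]
    have hz₂ : (ofLex z).1 ≤ b := by
      refine (Prod.Lex.monotone_fst _ _ hy).trans ?_
      rcases y with y | y
      exacts [hab.le, le_rfl]
    rcases hz₁.eq_or_lt with rfl | h
    · rcases x with x | x
      · rcases prod_sum_cases z with ⟨d, l, rfl⟩ | ⟨d, s, rfl⟩ | ⟨d, r, rfl⟩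
        · exact absurd hx (leftPt_lt_rightPt d l x).not_ge
        · exact absurd hx (midPt_lt_rightPt d s x).not_ge
        · exact ⟨toLex (.inl r), rfl⟩
      · exact absurd (Prod.Lex.monotone_fst _ _ hx) hab.lt.not_ge
    · have hb : (ofLex z).1 = b := le_antisymm hz₂ (not_lt.1 fun h' => hab.2 h h')
      subst hb
      rcases y with y | y
      · exact absurd (Prod.Lex.monotone_fst _ _ hy) hab.lt.not_ge
      · rcases prod_sum_cases z with ⟨d, l, rfl⟩ | ⟨d, s, rfl⟩ | ⟨d, r, rfl⟩
        · exact ⟨toLex (.inr l), rfl⟩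
        · exact absurd hy (leftPt_lt_midPt d y s).not_ge
        · exact absurd hy (leftPt_lt_rightPt d y r).not_ge

theorem exists_le_midPt [Nonempty S] {a : A} {z : A ×ₗ (L ⊕ₗ (S ⊕ₗ R))} (h : (ofLex z).1 ≤ a)
    (hz : z ∉ range (rightPt a)) : ∃ s, z ≤ midPt a s := by
  obtain ⟨s₀⟩ := ‹Nonempty S›
  rcases h.eq_or_lt with rfl | h
  · rcases prod_sum_cases z with ⟨d, l, rfl⟩ | ⟨d, s, rfl⟩ | ⟨d, r, rfl⟩
    · exact ⟨s₀, (leftPt_lt_midPt d l s₀).le⟩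
    · exact ⟨s, le_rfl⟩
    · exact absurd ⟨r, rfl⟩ hz
  · exact ⟨s₀, (prodLex_lt_of_fst_lt h).le⟩

theorem exists_midPt_le [Nonempty S] {a : A} {z : A ×ₗ (L ⊕ₗ (S ⊕ₗ R))} (h : a ≤ (ofLex z).1)
    (hz : z ∉ range (leftPt a)) : ∃ s, midPt a s ≤ z := by
  obtain ⟨s₀⟩ := ‹Nonempty S›
  rcases h.eq_or_lt with rfl | h
  · rcases prod_sum_cases z with ⟨d, l, rfl⟩ | ⟨d, s, rfl⟩ | ⟨d, r, rfl⟩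
    · exact absurd ⟨l, rfl⟩ hz
    · exact ⟨s, le_rfl⟩
    · exact ⟨s₀, (midPt_lt_rightPt d s₀ r).le⟩
  · exact ⟨s₀, (prodLex_lt_of_fst_lt h).le⟩

end Product

section ProductBlocks

variable {K : Type} {I : K → Type u} [∀ k, LinearOrder (I k)] {c : ℚ → K}
  {A L R : Type*} [LinearOrder A] [LinearOrder L] [LinearOrder R]

local notation "S" => Shuffle I c
local notation "Z" => A ×ₗ (L ⊕ₗ (Shuffle I c ⊕ₗ R))

theorem IsMinimalCollection.nonempty_shuffle (hI : IsMinimalCollection I c) : Nonempty S :=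
  hI.selfDoubling.1

/-- A point below some point of the middle segment at `a` is not close to a point above the whole
segment, as the final segments of the shuffle contain copies of it. -/
theorem IsMinimalCollection.not_close_of_forall_le (hI : IsMinimalCollection I c) {x y : Z} (a : A)
    (hx : ∃ s, x ≤ midPt a s) (hy : ∀ s, midPt a s ≤ y) : ¬ Close S x y := by
  obtain ⟨s, hs⟩ := hx
  obtain ⟨t, hst, ht⟩ := hI.exists_gt_not_close s
  exact not_close_mono (mt (convexEmb_midPt a).close_iff.1 ht) hs
    ((convexEmb_midPt a).strictMono hst).le (hy t)

theorem IsMinimalCollection.not_close_of_forall_ge (hI : IsMinimalCollection I c) {x y : Z} (a : A)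
    (hx : ∀ s, x ≤ midPt a s) (hy : ∃ s, midPt a s ≤ y) : ¬ Close S x y := by
  obtain ⟨s, hs⟩ := hy
  obtain ⟨t, hst, ht⟩ := hI.exists_lt_not_close s
  exact not_close_mono (mt (convexEmb_midPt a).close_iff.1 ht) (hx t)
    ((convexEmb_midPt a).strictMono hst).le hs

theorem IsMinimalCollection.isInner_midPt (hI : IsMinimalCollection I c) (a : A) (s : S) :
    IsInner S (midPt a s : Z) :=
  (convexEmb_midPt a).inner (hI.isInner_shuffle s)

theorem IsMinimalCollection.block_midPt (hI : IsMinimalCollection I c) (a : A) (s : S) :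
    block S (midPt a s : Z) ≅ₒ I (c (ofLex s).1) :=
  ((convexEmb_midPt a).block_ordIso (hI.isInner_shuffle s)).trans (hI.block_shuffle_ordIso s)

theorem IsMinimalCollection.exists_lt_of_fst_lt (hI : IsMinimalCollection I c) {z : Z} {a : A}
    (h : a < (ofLex z).1) : ∃ w < z, ¬ Close S w z := by
  obtain ⟨s⟩ := hI.nonempty_shuffle
  exact ⟨midPt a s, prodLex_lt_of_fst_lt h, hI.not_close_of_forall_le a ⟨s, le_rfl⟩
    fun t => (prodLex_lt_of_fst_lt h).le⟩

theorem IsMinimalCollection.exists_gt_of_fst_lt (hI : IsMinimalCollection I c) {z : Z} {a : A}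
    (h : (ofLex z).1 < a) : ∃ w, z < w ∧ ¬ Close S z w := by
  obtain ⟨s⟩ := hI.nonempty_shuffle
  exact ⟨midPt a s, prodLex_lt_of_fst_lt h, hI.not_close_of_forall_ge a
    (fun t => (prodLex_lt_of_fst_lt h).le) ⟨s, le_rfl⟩⟩

theorem IsMinimalCollection.isInner_leftPt (hI : IsMinimalCollection I c)
    (hL : ¬ HasCopy S (univ : Set L)) (a : A) (l : L) :
    IsInner S (leftPt a l : Z) ↔ ¬ IsBot a := by
  have hne := hI.nonempty_shuffle
  obtain ⟨s⟩ := hI.nonempty_shuffle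
  constructor
  · rintro ⟨⟨w, hw, hw'⟩, -⟩ ha
    have hmem : w ∈ range (leftPt a : L → Z) := by
      by_contra h
      obtain ⟨t, ht⟩ := exists_midPt_le (ha _) h
      exact ((leftPt_lt_midPt a l t).trans_le ht).not_gt hw
    exact hw' (close_of_not_hasCopy (convexEmb_leftPt a).ordConnected_range
      (not_hasCopy_range (convexEmb_leftPt a) hL) hmem ⟨l, rfl⟩)
  · intro ha
    simp only [IsBot, not_forall, not_le] at ha
    obtain ⟨b, hb⟩ := ha
    exact ⟨hI.exists_lt_of_fst_lt hb, midPt a s, leftPt_lt_midPt a l s,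
      hI.not_close_of_forall_ge a (fun t => (leftPt_lt_midPt a l t).le) ⟨s, le_rfl⟩⟩

theorem IsMinimalCollection.isInner_rightPt (hI : IsMinimalCollection I c)
    (hR : ¬ HasCopy S (univ : Set R)) (a : A) (r : R) :
    IsInner S (rightPt a r : Z) ↔ ¬ IsTop a := by
  have hne := hI.nonempty_shuffle
  obtain ⟨s⟩ := hI.nonempty_shuffle
  constructor
  · rintro ⟨-, ⟨w, hw, hw'⟩⟩ ha
    have hmem : w ∈ range (rightPt a : R → Z) := by
      by_contra h
      obtain ⟨t, ht⟩ := exists_le_midPt (ha _) h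
      exact (ht.trans_lt (midPt_lt_rightPt a t r)).not_gt hw
    exact hw' (close_of_not_hasCopy (convexEmb_rightPt a).ordConnected_range
      (not_hasCopy_range (convexEmb_rightPt a) hR) ⟨r, rfl⟩ hmem)
  · intro ha
    simp only [IsTop, not_forall, not_le] at ha
    obtain ⟨b, hb⟩ := ha
    exact ⟨⟨midPt a s, midPt_lt_rightPt a s r, hI.not_close_of_forall_le a ⟨s, le_rfl⟩
      fun t => (midPt_lt_rightPt a t r).le⟩, hI.exists_gt_of_fst_lt hb⟩

theorem midPt_le_gapPt {a b : A} (hab : a ⋖ b) (x : R ⊕ₗ L) (s : S) :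
    (midPt a s : Z) ≤ gapPt a b x := by
  rcases x with r | l
  · exact (midPt_lt_rightPt a s r).le
  · exact (prodLex_lt_of_fst_lt hab.lt).le

theorem gapPt_le_midPt {a b : A} (hab : a ⋖ b) (x : R ⊕ₗ L) (s : S) :
    (gapPt a b x : Z) ≤ midPt b s := by
  rcases x with r | l
  · exact (prodLex_lt_of_fst_lt hab.lt).le
  · exact (leftPt_lt_midPt b l s).le

/-- At an adjacent pair of points of `A`, the end segments `R` and `L` merge into a block. -/
theorem IsMinimalCollection.block_gapPt (hI : IsMinimalCollection I c)
    (hL : ¬ HasCopy S (univ : Set L)) (hR : ¬ HasCopy S (univ : Set R)) {a b : A} (hab : a ⋖ b)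
    (x : R ⊕ₗ L) : block S (gapPt a b x : Z) ≅ₒ (R ⊕ₗ L) := by
  have := hI.nonempty_shuffle
  have hnc : ¬ HasCopy S (range (gapPt a b : R ⊕ₗ L → Z)) := by
    intro h
    rcases h.or_of_cut hI.selfDoubling (s := range (rightPt a : R → Z))
      (t := range (leftPt b : L → Z)) (by
        rintro _ ⟨y | y, rfl⟩
        exacts [.inl ⟨y, rfl⟩, .inr ⟨y, rfl⟩]) (by
        rintro _ ⟨r, rfl⟩ _ ⟨l, rfl⟩
        exact (prodLex_lt_of_fst_lt hab.lt).le) with h | h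
    · exact not_hasCopy_range (convexEmb_rightPt a) hR h
    · exact not_hasCopy_range (convexEmb_leftPt b) hL h
  rw [block_eq_of_forall (convexEmb_gapPt hab).ordConnected_range hnc ⟨x, rfl⟩]
  · exact (convexEmb_gapPt hab).strictMono.ordIso_range
  intro y hy
  rcases le_or_gt (ofLex y).1 a with h | h
  · rw [close_comm]
    refine hI.not_close_of_forall_le a (exists_le_midPt h ?_) (midPt_le_gapPt hab x)
    rintro ⟨r, rfl⟩
    exact hy ⟨toLex (.inl r), rfl⟩
  · refine hI.not_close_of_forall_ge b (gapPt_le_midPt hab x)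
      (exists_midPt_le (not_lt.1 fun h' => hab.2 h h') ?_)
    rintro ⟨l, rfl⟩
    exact hy ⟨toLex (.inr l), rfl⟩

theorem IsMinimalCollection.isInner_gapPt (hI : IsMinimalCollection I c)
    {a b : A} (hab : a ⋖ b) (x : R ⊕ₗ L) : IsInner S (gapPt a b x : Z) := by
  obtain ⟨s⟩ := hI.nonempty_shuffle
  have h₁ := hI.not_close_of_forall_le a ⟨s, le_rfl⟩ (midPt_le_gapPt hab x)
  have h₂ := hI.not_close_of_forall_ge b (gapPt_le_midPt hab x) ⟨s, le_rfl⟩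
  refine ⟨⟨_, lt_of_le_of_ne (midPt_le_gapPt hab x s) ?_, h₁⟩,
    _, lt_of_le_of_ne (gapPt_le_midPt hab x s) ?_, h₂⟩
  · intro h; exact h₁ (h ▸ close_refl hI.selfDoubling _)
  · intro h; exact h₂ (h ▸ close_refl hI.selfDoubling _)

theorem IsMinimalCollection.block_rightPt (hI : IsMinimalCollection I c)
    (hR : ¬ HasCopy S (univ : Set R)) {a : A} (ha : ∀ b, ¬ a ⋖ b) (r : R) :
    block S (rightPt a r : Z) ≅ₒ R := by
  have hne := hI.nonempty_shuffle
  obtain ⟨s⟩ := hI.nonempty_shuffle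
  rw [block_eq_of_forall (convexEmb_rightPt a).ordConnected_range
    (not_hasCopy_range (convexEmb_rightPt a) hR) ⟨r, rfl⟩]
  · exact (convexEmb_rightPt a).strictMono.ordIso_range
  intro y hy
  rcases le_or_gt (ofLex y).1 a with h | h
  · rw [close_comm]
    exact hI.not_close_of_forall_le a (exists_le_midPt h hy) fun s => (midPt_lt_rightPt a s r).le
  · obtain ⟨m, h₁, h₂⟩ := (not_covBy_iff h).1 (ha _)
    exact hI.not_close_of_forall_le m ⟨s, (prodLex_lt_of_fst_lt h₁).le⟩
      fun s => (prodLex_lt_of_fst_lt h₂).le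

theorem IsMinimalCollection.block_leftPt (hI : IsMinimalCollection I c)
    (hL : ¬ HasCopy S (univ : Set L)) {a : A} (ha : ∀ b, ¬ b ⋖ a) (l : L) :
    block S (leftPt a l : Z) ≅ₒ L := by
  have hne := hI.nonempty_shuffle
  obtain ⟨s⟩ := hI.nonempty_shuffle
  rw [block_eq_of_forall (convexEmb_leftPt a).ordConnected_range
    (not_hasCopy_range (convexEmb_leftPt a) hL) ⟨l, rfl⟩]
  · exact (convexEmb_leftPt a).strictMono.ordIso_range
  intro y hy
  rcases le_or_gt a (ofLex y).1 with h | h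
  · exact hI.not_close_of_forall_ge a (fun s => (leftPt_lt_midPt a l s).le) (exists_midPt_le h hy)
  · obtain ⟨m, h₁, h₂⟩ := (not_covBy_iff h).1 (ha _)
    rw [close_comm]
    exact hI.not_close_of_forall_le m ⟨s, (prodLex_lt_of_fst_lt h₁).le⟩
      fun s => (prodLex_lt_of_fst_lt h₂).le

end ProductBlocks

/-! ### The orders absorbed by `L + ℚ[I_k] + R` -/

section Absorption

variable {K : Type} {I : K → Type u} [∀ k, LinearOrder (I k)] {c : ℚ → K}
  {A L R : Type u} [LinearOrder A] [LinearOrder L] [LinearOrder R]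

/-- The merged ends `R + L` occurring at the jumps of `A`, and the ends `R` and `L` occurring at
its points without successor or predecessor, are members of the collection. -/
structure EndsAreMembers (I : K → Type u) [∀ k, LinearOrder (I k)] (A L R : Type u)
    [LinearOrder A] [LinearOrder L] [LinearOrder R] : Prop where
  gap : ∀ a b : A, a ⋖ b → Nonempty (R ⊕ₗ L) → IsoToMember I (R ⊕ₗ L)
  right : ∀ a : A, ¬ IsTop a → (∀ b, ¬ a ⋖ b) → Nonempty R → IsoToMember I R
  left : ∀ a : A, ¬ IsBot a → (∀ b, ¬ b ⋖ a) → Nonempty L → IsoToMember I L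

theorem IsoToMember.of_ordIso {X Y : Type u} [LinearOrder X] [LinearOrder Y]
    (h : IsoToMember I X) (e : Y ≅ₒ X) : IsoToMember I Y :=
  let ⟨k, hk⟩ := h; ⟨k, e.trans hk⟩

/-- The condition on the inner blocks of `A (L + ℚ[I_k] + R)`, expressed by `A`, `L` and `R`. -/
theorem IsMinimalCollection.forall_block_iff (hI : IsMinimalCollection I c)
    (hL : ¬ HasCopy (Shuffle I c) (univ : Set L)) (hR : ¬ HasCopy (Shuffle I c) (univ : Set R)) :
    (∀ z : A ×ₗ (L ⊕ₗ (Shuffle I c ⊕ₗ R)), IsInner (Shuffle I c) z →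
      IsoToMember I (block (Shuffle I c) z)) ↔ EndsAreMembers I A L R := by
  constructor
  · intro h
    refine ⟨fun a b hab ⟨x⟩ => ?_, fun a ha ha' ⟨r⟩ => ?_, fun a ha ha' ⟨l⟩ => ?_⟩
    · exact (h _ (hI.isInner_gapPt hab x)).of_ordIso (hI.block_gapPt hL hR hab x).symm
    · exact (h _ ((hI.isInner_rightPt hR a r).2 ha)).of_ordIso (hI.block_rightPt hR ha' r).symm
    · exact (h _ ((hI.isInner_leftPt hL a l).2 ha)).of_ordIso (hI.block_leftPt hL ha' l).symm
  · intro h z hz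
    rcases prod_sum_cases z with ⟨a, l, rfl⟩ | ⟨a, s, rfl⟩ | ⟨a, r, rfl⟩
    · by_cases ha : ∃ b, b ⋖ a
      · obtain ⟨b, hab⟩ := ha
        exact (h.gap b a hab ⟨toLex (.inr l)⟩).of_ordIso
          (hI.block_gapPt hL hR hab (toLex (.inr l)))
      · push Not at ha
        exact (h.left a ((hI.isInner_leftPt hL a l).1 hz) ha ⟨l⟩).of_ordIso
          (hI.block_leftPt hL ha l)
    · exact ⟨_, hI.block_midPt a s⟩
    · by_cases ha : ∃ b, a ⋖ b
      · obtain ⟨b, hab⟩ := ha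
        exact (h.gap a b hab ⟨toLex (.inl r)⟩).of_ordIso
          (hI.block_gapPt hL hR hab (toLex (.inl r)))
      · push Not at ha
        exact (h.right a ((hI.isInner_rightPt hR a r).1 hz) ha ⟨r⟩).of_ordIso
          (hI.block_rightPt hR ha r)

theorem endsAreMembers_punit : EndsAreMembers I PUnit.{u + 1} L R where
  gap _ _ h := absurd h.lt (lt_irrefl _)
  right _ h := absurd (fun _ => le_rfl) h
  left _ h := absurd (fun _ => le_rfl) h

/-- The criterion for absorption, stated for the representations in which neither `L` nor `R`
contains a convex copy of the shuffle. -/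
theorem IsMinimalCollection.leftAbsorbs_iff [Countable A] [Countable L] [Countable R]
    (hI : IsMinimalCollection I c)
    (hL : ¬ HasCopy (Shuffle I c) (univ : Set L)) (hR : ¬ HasCopy (Shuffle I c) (univ : Set R)) :
    LeftAbsorbs (L ⊕ₗ (Shuffle I c ⊕ₗ R)) A ↔
      Nonempty A ∧ (Nonempty L → HasLeftEndpoint A) ∧ (Nonempty R → HasRightEndpoint A) ∧
        EndsAreMembers I A L R := by
  have hP := hI.selfDoubling
  obtain ⟨s₀⟩ := hI.nonempty_shuffle
  constructor
  · intro h
    -- regard `X` as `1 X`, so that the description of the blocks applies to both sides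
    obtain ⟨e⟩ := h.trans (OrdIso.unit_prodLex.{u} (L ⊕ₗ (Shuffle I c ⊕ₗ R))).symm
    refine ⟨⟨(ofLex (e.symm (midPt ⟨⟩ s₀))).1⟩, fun ⟨l⟩ => ?_, fun ⟨r⟩ => ?_, ?_⟩
    · refine ⟨(ofLex (e.symm (leftPt ⟨⟩ l))).1, fun a => not_lt.1 fun h => ?_⟩
      obtain ⟨w, hw, hw'⟩ := hI.exists_lt_of_fst_lt h
      have hw₁ : e w < leftPt ⟨⟩ l := e.lt_symm_apply.1 hw
      have hw₂ : ¬ Close (Shuffle I c) (e w) (leftPt ⟨⟩ l) := by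
        rwa [← e.apply_symm_apply (leftPt ⟨⟩ l), e.convexEmb.close_iff]
      exact (hI.isInner_leftPt hL PUnit.unit l).1
        ⟨⟨e w, hw₁, hw₂⟩, midPt ⟨⟩ s₀, leftPt_lt_midPt _ _ _,
        hI.not_close_of_forall_ge ⟨⟩ (fun s => (leftPt_lt_midPt _ _ s).le) ⟨s₀, le_rfl⟩⟩
        fun _ => le_rfl
    · refine ⟨(ofLex (e.symm (rightPt ⟨⟩ r))).1, fun a => not_lt.1 fun h => ?_⟩
      obtain ⟨w, hw, hw'⟩ := hI.exists_gt_of_fst_lt h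
      have hw₁ : rightPt ⟨⟩ r < e w := e.symm_apply_lt.1 hw
      have hw₂ : ¬ Close (Shuffle I c) (rightPt ⟨⟩ r) (e w) := by
        rwa [← e.apply_symm_apply (rightPt ⟨⟩ r), e.convexEmb.close_iff]
      exact (hI.isInner_rightPt hR PUnit.unit r).1
        ⟨⟨midPt ⟨⟩ s₀, midPt_lt_rightPt _ _ _,
        hI.not_close_of_forall_le ⟨⟩ ⟨s₀, le_rfl⟩ fun s => (midPt_lt_rightPt _ s _).le⟩,
        e w, hw₁, hw₂⟩
        fun _ => le_rfl
    · rw [← hI.forall_block_iff hL hR]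
      intro z hz
      exact ((hI.forall_block_iff hL hR).2 endsAreMembers_punit _ (e.convexEmb.inner hz)).of_ordIso
        (e.convexEmb.block_ordIso hz).symm
  · rintro ⟨⟨a⟩, hleft, hright, hmem⟩
    rw [← hI.forall_block_iff hL hR] at hmem
    obtain ⟨a₀, ha₀⟩ : ∃ a₀ : A, Nonempty L → IsBot a₀ := by
      by_cases h : Nonempty L
      · obtain ⟨a₀, ha₀⟩ := hleft h; exact ⟨a₀, fun _ => ha₀⟩
      · exact ⟨a, fun h' => absurd h' h⟩
    obtain ⟨a₁, ha₁⟩ : ∃ a₁ : A, Nonempty R → IsTop a₁ := by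
      by_cases h : Nonempty R
      · obtain ⟨a₁, ha₁⟩ := hright h; exact ⟨a₁, fun _ => ha₁⟩
      · exact ⟨a, fun h' => absurd h' h⟩
    have : ∀ k, Countable (I k) := hI.countable
    have : Countable (A ×ₗ (L ⊕ₗ (Shuffle I c ⊕ₗ R))) :=
      inferInstanceAs (Countable (A × (L ⊕ ((Σ q, I (c q)) ⊕ R))))
    have hM : {z : A ×ₗ (L ⊕ₗ (Shuffle I c ⊕ₗ R)) | IsInner (Shuffle I c) z} ≅ₒ Shuffle I c :=
      ordIso_shuffle_of_blocks hP ordConnected_setOf_isInner ⟨_, hI.isInner_midPt a s₀⟩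
        (fun x hx => hx.exists_lt hP) (fun x hx => hx.exists_gt hP) hI.dense hmem
        (fun x _ y _ hxy h k => hI.exists_block_ordIso hxy h k)
    obtain ⟨e⟩ := hM
    refine sumLex_ordIso (f := leftPt a₀) (g := fun s => (e.symm s).1) (h := rightPt a₁)
      (convexEmb_leftPt a₀).strictMono (fun x y hxy => e.symm.strictMono hxy)
      (convexEmb_rightPt a₁).strictMono ?_ ?_ ?_ ?_
    · intro l s
      obtain ⟨z, hz⟩ := e.symm s
      change leftPt a₀ l < z
      by_contra! h
      have h' := (hI.isInner_leftPt (A := A) (R := R) hL a₀ l).not_left.2 (ha₀ ⟨l⟩)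
      obtain ⟨w, hw, hwz⟩ := hz.1
      exact h' ⟨⟨w, hw.trans_le h, not_close_mono hwz le_rfl hw.le h⟩, midPt a₀ s₀,
        leftPt_lt_midPt _ _ _,
        hI.not_close_of_forall_ge a₀ (fun s => (leftPt_lt_midPt _ _ s).le) ⟨s₀, le_rfl⟩⟩
    · intro s r
      obtain ⟨z, hz⟩ := e.symm s
      change z < rightPt a₁ r
      by_contra! h
      have h' := (hI.isInner_rightPt (A := A) (L := L) hR a₁ r).not_left.2 (ha₁ ⟨r⟩)
      obtain ⟨w, hw, hwz⟩ := hz.2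
      exact h' ⟨⟨midPt a₁ s₀, midPt_lt_rightPt _ _ _,
        hI.not_close_of_forall_le a₁ ⟨s₀, le_rfl⟩ fun s => (midPt_lt_rightPt _ s _).le⟩,
        w, h.trans_lt hw, not_close_mono hwz h hw.le le_rfl⟩
    · intro l r
      rcases (ha₀ ⟨l⟩ a₁).eq_or_lt with h | h
      · rw [h]; exact leftPt_lt_rightPt _ _ _
      · exact prodLex_lt_of_fst_lt h
    · intro z
      by_cases hz : IsInner (Shuffle I c) z
      · exact .inr (.inl ⟨e ⟨z, hz⟩, by simp⟩)
      rcases prod_sum_cases z with ⟨a, l, rfl⟩ | ⟨a, s, rfl⟩ | ⟨a, r, rfl⟩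
      · rw [hI.isInner_leftPt hL, not_not] at hz
        rw [le_antisymm (hz a₀) (ha₀ ⟨l⟩ a)]
        exact .inl ⟨l, rfl⟩
      · exact absurd (hI.isInner_midPt a s) hz
      · rw [hI.isInner_rightPt hR, not_not] at hz
        rw [le_antisymm (ha₁ ⟨r⟩ a) (hz a₁)]
        exact .inr (.inr ⟨r, rfl⟩)

end Absorption

/-! ### The decomposition of a left-absorbing order -/

section Decomposition

theorem SelfDoubling.hasCopy_inner {P Z : Type*} [LinearOrder P] [LinearOrder Z]
    (hP : SelfDoubling P) {z : Z} (hz : IsInner P z) :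
    HasCopy P (univ : Set {x : Z | IsInner P x}) := by
  obtain ⟨w, hw, hwz, hwc⟩ := hz.exists_lt hP
  have hcopy : HasCopy P {x : Z | IsInner P x} :=
    (not_not.1 hwc : HasCopy P (uIcc w z)).mono (ordConnected_setOf_isInner.uIcc_subset hw hz)
  exact (hcopy.preimage ordConnected_setOf_isInner.convexEmb_val (by simp)).mono (subset_univ _)

theorem LeftAbsorbing.selfDoubling {X : Type u} [LinearOrder X] [Nonempty X]
    (h : LeftAbsorbing X) : SelfDoubling X := by
  obtain ⟨A, _, _, ⟨e⟩⟩ := h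
  obtain ⟨a, b, hab⟩ := exists_pair_lt A
  exact ⟨inferInstance, _, _, e.convexEmb.comp (convexEmb_prodLex_mk a),
    e.convexEmb.comp (convexEmb_prodLex_mk b), fun x y => e.strictMono (prodLex_lt_of_fst_lt hab)⟩

/-- The middle part of a countable self-doubling order `X`, formed by its inner points, is the
shuffle of the types of the inner blocks. Any two blocks have a copy of `X` between them, hence
every type of inner block, which makes the types densely distributed. -/
theorem SelfDoubling.exists_shuffle {X : Type u} [LinearOrder X] [Countable X]
    (hX : SelfDoubling X) :
    ∃ (K : Type) (I : K → Type u) (_ : ∀ k, LinearOrder (I k)) (c : ℚ → K),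
      IsMinimalCollection I c ∧ {x : X | IsInner X x} ≅ₒ Shuffle I c := by
  obtain ⟨x, -, y, -, hxy, hc⟩ :=
    hX.exists_not_close (s := (univ : Set X)) ⟨id, (OrderIso.refl X).convexEmb, fun _ => mem_univ _⟩
  obtain ⟨z, h₁, h₂, h₃, h₄⟩ := exists_between_not_close hX hxy hc
  have hz : IsInner X z := ⟨⟨x, h₁, h₃⟩, y, h₂, h₄⟩
  obtain ⟨D, hDM, hD, hMD, _, _, _, hiso⟩ := exists_ordIso_sigma_block hX
    (ordConnected_setOf_isInner (P := X) (Z := X)) (fun x hx => hx.exists_lt hX)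
    (fun x hx => hx.exists_gt hX)
  obtain ⟨d, hd, -⟩ := hMD z hz
  have : Nonempty D := ⟨⟨d, hd⟩⟩
  obtain ⟨e⟩ := Order.iso_of_countable_dense D ℚ
  -- the isomorphism types of the blocks are indexed by a quotient of `ℚ`, as the index set has to
  -- live in `Type`
  let s : Setoid ℚ := ⟨fun q r => block X (e.symm q).1 ≅ₒ block X (e.symm r).1,
    fun q => ⟨OrderIso.refl _⟩, OrdIso.symm, OrdIso.trans⟩
  let I : Quotient s → Type u := fun k => block X (e.symm k.out).1
  let c : ℚ → Quotient s := Quotient.mk s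
  have hIc : ∀ d : D, block X d.1 ≅ₒ I (c (e d)) := fun d => by
    have h : block X (e.symm (e d)).1 ≅ₒ block X (e.symm (c (e d)).out).1 :=
      OrdIso.symm (Quotient.exact (s := s) (Quotient.out_eq (c (e d))))
    rwa [e.symm_apply_apply] at h
  have hshuffle : {x : X | IsInner X x} ≅ₒ Shuffle I c := hiso.trans (sigmaLex_ordIso e hIc)
  refine ⟨Quotient s, I, fun k => inferInstanceAs (LinearOrder (block X (e.symm k.out).1)), c,
    ⟨inferInstance, fun k => inferInstanceAs (Countable (block X (e.symm k.out).1)),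
      fun k => ⟨⟨_, mem_block_self hX _⟩⟩, fun k => ?_, fun k => ?_⟩, hshuffle⟩
  · refine dense_of_exists_between fun q r hqr => ?_
    have hlt : (e.symm q).1 < (e.symm r).1 := e.symm.strictMono hqr
    have hc' : ¬ Close X (e.symm q).1 (e.symm r).1 := fun h =>
      hlt.ne (hD _ (e.symm q).2 _ (e.symm r).2 h)
    obtain ⟨g, hg, hg'⟩ := not_not.1 hc'
    rw [uIcc_of_le hlt.le] at hg'
    have hk : IsInner X (e.symm k.out).1 := hDM (e.symm k.out).2
    obtain ⟨⟨w, hw, hwc⟩, ⟨v, hv, hvc⟩⟩ := hk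
    -- the copy `g` of `X` between two representatives carries the block of type `k` to a block
    obtain ⟨d, hd, hgd⟩ := hMD _ (hg.inner (hDM (e.symm k.out).2))
    have hdk : block X d ≅ₒ I k := by
      rw [← block_eq hX hgd]
      exact hg.block_ordIso (hDM (e.symm k.out).2)
    refine ⟨e ⟨d, hd⟩, ?_, ?_, ?_⟩
    · rw [mem_preimage, mem_singleton_iff, ← Quotient.out_eq k]
      refine Quotient.sound (s := s) ?_
      change block X (e.symm (e ⟨d, hd⟩)).1 ≅ₒ I k
      rwa [e.symm_apply_apply]
    · rw [← e.symm_apply_lt]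
      change (e.symm q).1 < d
      by_contra! h
      exact hwc (hg.close_iff.1 (hgd.symm.of_mem (by
        rw [mem_uIcc]
        exact .inl ⟨h.trans (hg' w).1, (hg.strictMono hw).le⟩) right_mem_uIcc))
    · rw [← e.lt_symm_apply]
      change d < (e.symm r).1
      by_contra! h
      exact hvc (hg.close_iff.1 (hgd.of_mem left_mem_uIcc (by
        rw [mem_uIcc]
        exact .inl ⟨(hg.strictMono hv).le, (hg' v).2.trans h⟩)))
  · rw [containsConvexCopy_iff]
    intro h
    obtain ⟨e'⟩ := hshuffle
    have hS : HasCopy X (univ : Set (Shuffle I c)) :=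
      ((hX.hasCopy_inner hz).image e'.convexEmb).mono (subset_univ _)
    refine not_hasCopy_block hX (e.symm k.out).1
      (((h.trans hS).image (ordConnected_block hX (e.symm k.out).1).convexEmb_val).mono ?_)
    rintro _ ⟨y, -, rfl⟩
    exact y.2

/-- The least and the greatest block contain no copy of the shuffle, because the shuffle contains a
copy of `X` and a block does not. -/
theorem SelfDoubling.exists_decomposition {X : Type u} [LinearOrder X] [Countable X]
    (hX : SelfDoubling X) :
    ∃ (K : Type) (I : K → Type u) (_ : ∀ k, LinearOrder (I k)) (c : ℚ → K)
        (L R : Type u) (_ : LinearOrder L) (_ : LinearOrder R),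
        IsMinimalCollection I c ∧ Countable L ∧ Countable R ∧
        X ≅ₒ (L ⊕ₗ (Shuffle I c ⊕ₗ R)) ∧
        ¬ HasCopy (Shuffle I c) (univ : Set L) ∧ ¬ HasCopy (Shuffle I c) (univ : Set R) := by
  obtain ⟨K, I, _, c, hI, ⟨e⟩⟩ := hX.exists_shuffle
  obtain ⟨s⟩ := hI.nonempty_shuffle
  obtain ⟨z, hz⟩ := e.symm s
  have hS : HasCopy X (univ : Set (Shuffle I c)) :=
    ((hX.hasCopy_inner hz).image e.convexEmb).mono (subset_univ _)
  let U : Set X := {x | ∀ w < x, Close X w x}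
  let V : Set X := {x | ∀ w, x < w → Close X x w}
  have hU : ∀ u ∈ U, ∀ m, IsInner X m → u < m := by
    intro u hu m ⟨⟨w, hw, hwm⟩, _⟩
    by_contra! h
    exact hwm ((hu w (hw.trans_le h)).of_mem left_mem_uIcc (Icc_subset_uIcc ⟨hw.le, h⟩))
  have hV : ∀ m, IsInner X m → ∀ v ∈ V, m < v := by
    intro m ⟨_, ⟨w, hw, hwm⟩⟩ v hv
    by_contra! h
    exact hwm ((hv w (h.trans_lt hw)).of_mem (Icc_subset_uIcc ⟨h, hw.le⟩) right_mem_uIcc)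
  refine ⟨K, I, _, c, U, V, inferInstance, inferInstance, hI, inferInstance, inferInstance,
    ?_, ?_, ?_⟩
  · refine sumLex_ordIso (f := Subtype.val) (g := fun s => (e.symm s).1) (h := Subtype.val)
      (fun _ _ h => h) (fun _ _ h => e.symm.strictMono h) (fun _ _ h => h)
      (fun u s => hU u u.2 _ (e.symm s).2) (fun s v => hV _ (e.symm s).2 v v.2)
      (fun u v => (hU u u.2 z hz).trans (hV z hz v v.2)) fun x => ?_
    by_cases hx : IsInner X x
    · exact .inr (.inl ⟨e ⟨x, hx⟩, by simp⟩)
    · rw [IsInner, not_and_or] at hx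
      push Not at hx
      rcases hx with hx | hx
      · exact .inl ⟨⟨x, hx⟩, rfl⟩
      · exact .inr (.inr ⟨⟨x, hx⟩, rfl⟩)
  · intro h
    obtain ⟨x, -, y, -, hxy, hc⟩ := hX.exists_not_close (h.trans hS)
    have hUc : U.OrdConnected := ⟨fun a _ b hb d hd w hw =>
      (hb w (hw.trans_le hd.2)).of_mem left_mem_uIcc (Icc_subset_uIcc ⟨hw.le, hd.2⟩)⟩
    exact hc (hUc.convexEmb_val.close_iff.1 (y.2 _ hxy))
  · intro h
    obtain ⟨x, -, y, -, hxy, hc⟩ := hX.exists_not_close (h.trans hS)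
    have hVc : V.OrdConnected := ⟨fun a ha b _ d hd w hw =>
      (ha w (hd.1.trans_lt hw)).of_mem (Icc_subset_uIcc ⟨hd.1, hw.le⟩) right_mem_uIcc⟩
    exact hc (hVc.convexEmb_val.close_iff.1 (x.2 _ hxy))

end Decomposition

/-! ### Jumps and endpoints of `A` -/

section Jumps

variable {A : Type*} [LinearOrder A]

theorem HasSuccessors.exists_covBy [Nontrivial A] (h : HasSuccessors A) : ∃ a b : A, a ⋖ b :=
  let ⟨a, _, hab⟩ := exists_pair_lt A; ⟨a, h a fun h' => (h' _).not_gt hab⟩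

theorem HasPredecessors.exists_covBy [Nontrivial A] (h : HasPredecessors A) : ∃ a b : A, a ⋖ b :=
  let ⟨_, b, hab⟩ := exists_pair_lt A
  let ⟨a, ha⟩ := h b fun h' => (h' _).not_gt hab
  ⟨a, b, ha⟩

theorem ordIso_of_endpoints_of_not_covBy_iff [Countable A] :
    (HasLeftEndpoint A ∧ HasRightEndpoint A ∧ ∀ a b : A, ¬ a ⋖ b) ↔
      A ≅ₒ (Unit ⊕ₗ (ℚ ⊕ₗ Unit)) ∨ A ≅ₒ Unit := by
  constructor
  · rintro ⟨⟨a, ha⟩, ⟨b, hb⟩, h⟩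
    -- a single point if the endpoints coincide, otherwise Cantor's theorem applies between them
    rcases (ha b).eq_or_lt with rfl | hab
    · exact .inr (StrictMono.ordIso (g := fun _ => ())
        (fun x y hxy => absurd hxy ((hb y).trans (ha x)).not_gt)
        fun _ => ⟨a, rfl⟩)
    · left
      have : DenselyOrdered A := ⟨fun x y hxy => (not_covBy_iff hxy).1 (h x y)⟩
      have : Nonempty (Ioo a b) := nonempty_Ioo_subtype hab
      obtain ⟨e⟩ := Order.iso_of_countable_dense ℚ (Ioo a b)
      refine sumLex_ordIso (f := fun _ => a) (g := fun q => (e q).1) (h := fun _ => b)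
        (Subsingleton.strictMono _) (fun x y hxy => e.strictMono hxy) (Subsingleton.strictMono _)
        (fun _ q => (e q).2.1) (fun q _ => (e q).2.2) (fun _ _ => hab) fun y => ?_
      rcases (ha y).eq_or_lt with rfl | hay
      · exact .inl ⟨(), rfl⟩
      rcases (hb y).eq_or_lt with rfl | hyb
      · exact .inr (.inr ⟨(), rfl⟩)
      · exact .inr (.inl ⟨e.symm ⟨y, hay, hyb⟩, by simp⟩)
  · have key : ∀ {B : Type} [LinearOrder B] [DenselyOrdered B] [BoundedOrder B], A ≅ₒ B →
        HasLeftEndpoint A ∧ HasRightEndpoint A ∧ ∀ a b : A, ¬ a ⋖ b := by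
      rintro B _ _ _ ⟨e⟩
      exact ⟨⟨e.symm ⊥, fun a => e.symm_apply_le.2 bot_le⟩,
        ⟨e.symm ⊤, fun a => e.le_symm_apply.2 le_top⟩,
        fun a b hab => not_covBy ((apply_covBy_apply_iff e).2 hab)⟩
    rintro (h | h)
    exacts [key h, key h]

end Jumps

/-! ### The eight cases -/

section Cases

variable {K : Type} {I : K → Type u} [∀ k, LinearOrder (I k)] {c : ℚ → K}
  {A L R : Type u} [LinearOrder A] [LinearOrder L] [LinearOrder R]

theorem IsMinimalCollection.nonempty_of_isoToMember (hI : IsMinimalCollection I c)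
    {Y : Type u} [LinearOrder Y] (h : IsoToMember I Y) : Nonempty Y :=
  let ⟨k, ⟨e⟩⟩ := h; (hI.nonempty k).map e.symm

theorem IsMinimalCollection.not_hasCopy_of_isoToMember (hI : IsMinimalCollection I c)
    {Y : Type u} [LinearOrder Y] (h : IsoToMember I Y) :
    ¬ HasCopy (Shuffle I c) (univ : Set Y) :=
  let ⟨k, ⟨e⟩⟩ := h
  fun h' => hI.not_hasCopy k ((h'.image e.convexEmb).mono (subset_univ _))

theorem IsMinimalCollection.not_hasCopy_of_isEmpty (hI : IsMinimalCollection I c)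
    {Y : Type u} [LinearOrder Y] (h : IsEmpty Y) : ¬ HasCopy (Shuffle I c) (univ : Set Y) :=
  fun ⟨g, _⟩ => hI.nonempty_shuffle.elim fun s => h.false (g s)

theorem nonempty_sumLex_iff {R L : Type*} : Nonempty (R ⊕ₗ L) ↔ Nonempty R ∨ Nonempty L :=
  nonempty_sum

theorem isoToMember_congr {X Y : Type u} [LinearOrder X] [LinearOrder Y] (e : X ≅ₒ Y) :
    IsoToMember I X ↔ IsoToMember I Y :=
  ⟨fun h => h.of_ordIso e.symm, fun h => h.of_ordIso e⟩

theorem isoToMember_sumLex_of_isEmpty_left (h : ¬ Nonempty R) :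
    IsoToMember I (R ⊕ₗ L) ↔ IsoToMember I L :=
  have := not_nonempty_iff.1 h; isoToMember_congr ⟨OrderIso.emptySumLex⟩

theorem isoToMember_sumLex_of_isEmpty_right (h : ¬ Nonempty L) :
    IsoToMember I (R ⊕ₗ L) ↔ IsoToMember I R :=
  have := not_nonempty_iff.1 h; isoToMember_congr ⟨OrderIso.sumLexEmpty⟩

theorem endsAreMembers_iff : EndsAreMembers I A L R ↔
    (Nonempty R ∨ Nonempty L → IsoToMember I (R ⊕ₗ L) ∨ ∀ a b : A, ¬ a ⋖ b) ∧
    (Nonempty R → IsoToMember I R ∨ HasSuccessors A) ∧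
    (Nonempty L → IsoToMember I L ∨ HasPredecessors A) := by
  rw [← nonempty_sumLex_iff]
  constructor
  · rintro ⟨h₁, h₂, h₃⟩
    refine ⟨fun h => ?_, fun h => ?_, fun h => ?_⟩ <;> by_contra! H
    · obtain ⟨a, b, hab⟩ := H.2
      exact H.1 (h₁ a b hab h)
    · refine H.2 fun a ha => ?_
      by_contra! ha'
      exact H.1 (h₂ a ha ha' h)
    · refine H.2 fun a ha => ?_
      by_contra! ha'
      exact H.1 (h₃ a ha ha' h)
  · rintro ⟨h₁, h₂, h₃⟩
    refine ⟨fun a b hab h => (h₁ h).resolve_right fun h' => h' a b hab,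
      fun a ha ha' h => (h₂ h).resolve_right fun h' => ?_,
      fun a ha ha' h => (h₃ h).resolve_right fun h' => ?_⟩
    · obtain ⟨b, hb⟩ := h' a ha; exact ha' b hb
    · obtain ⟨b, hb⟩ := h' a ha; exact ha' b hb

theorem IsMinimalCollection.not_hasCopy_of_endCondition (hI : IsMinimalCollection I c) {n : ℕ}
    (h : EndCondition I L R n) :
    ¬ HasCopy (Shuffle I c) (univ : Set L) ∧ ¬ HasCopy (Shuffle I c) (univ : Set R) := by
  have hsum : IsoToMember I (R ⊕ₗ L) →
      ¬ HasCopy (Shuffle I c) (univ : Set L) ∧ ¬ HasCopy (Shuffle I c) (univ : Set R) := fun h =>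
    have h' := hI.not_hasCopy_of_isoToMember h
    ⟨fun hc => h' ((hc.image (convexEmb_sumLex_inr R L)).mono (subset_univ _)),
      fun hc => h' ((hc.image (convexEmb_sumLex_inl R L)).mono (subset_univ _))⟩
  match n, h with
  | 1, h => exact ⟨hI.not_hasCopy_of_isEmpty h.1, hI.not_hasCopy_of_isEmpty h.2⟩
  | 2, h => exact ⟨hI.not_hasCopy_of_isoToMember h.1, hI.not_hasCopy_of_isEmpty h.2⟩
  | 3, h => exact ⟨hI.not_hasCopy_of_isEmpty h.2, hI.not_hasCopy_of_isoToMember h.1⟩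
  | 4, h => exact ⟨hI.not_hasCopy_of_isoToMember h.1, hI.not_hasCopy_of_isoToMember h.2.1⟩
  | 5, h => exact hsum h.1
  | 6, h => exact hsum h.2.1
  | 7, h => exact hsum h.2.1
  | 8, h => exact hsum h.1

/-- The eight conditions exclude each other. -/
theorem IsMinimalCollection.endCondition_unique (hI : IsMinimalCollection I c) {m n : ℕ}
    (hm : EndCondition I L R m) (hn : EndCondition I L R n) : m = n := by
  have h₁ : IsoToMember I L → Nonempty L := hI.nonempty_of_isoToMember
  have h₂ : IsoToMember I R → Nonempty R := hI.nonempty_of_isoToMember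
  have h₃ := isoToMember_sumLex_of_isEmpty_left (I := I) (L := L) (R := R)
  have h₄ := isoToMember_sumLex_of_isEmpty_right (I := I) (L := L) (R := R)
  rcases m with _ | _ | _ | _ | _ | _ | _ | _ | _ | m <;>
  rcases n with _ | _ | _ | _ | _ | _ | _ | _ | _ | n <;>
  first
  | rfl
  | exact hm.elim
  | exact hn.elim
  | (exfalso
     simp only [zero_add, Nat.reduceAdd, EndCondition, ← not_nonempty_iff] at hm hn
     tauto)

/-- If a nontrivial `A` is absorbed, one of the eight conditions holds, since a nontrivial `A`
without jumps has a point other than its right endpoint without successor, and a point other than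
its left endpoint without predecessor. -/
theorem EndsAreMembers.exists_endCondition [Nontrivial A]
    (h : EndsAreMembers I A L R) : ∃ n, EndCondition I L R n := by
  have h₁ : HasSuccessors A → ¬ ∀ a b : A, ¬ a ⋖ b := fun h => by
    obtain ⟨a, b, hab⟩ := h.exists_covBy
    exact fun h' => h' a b hab
  have h₂ : HasPredecessors A → ¬ ∀ a b : A, ¬ a ⋖ b := fun h => by
    obtain ⟨a, b, hab⟩ := h.exists_covBy
    exact fun h' => h' a b hab
  obtain ⟨hgap, hright, hleft⟩ := endsAreMembers_iff.1 h
  by_cases hL : Nonempty L <;> by_cases hR : Nonempty R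
  · by_cases hRL : IsoToMember I (R ⊕ₗ L)
    · by_cases hL' : IsoToMember I L <;> by_cases hR' : IsoToMember I R
      exacts [⟨8, hRL, hL', hR'⟩, ⟨6, hR, hRL, hL', hR'⟩,
        ⟨7, hL, hRL, hR', hL'⟩, ⟨5, hRL, hL', hR'⟩]
    · have hA := (hgap (.inl hR)).resolve_left hRL
      exact ⟨4, (hleft hL).resolve_right fun h => h₂ h hA,
        (hright hR).resolve_right fun h => h₁ h hA, hRL⟩
  · refine ⟨2, ?_, not_nonempty_iff.1 hR⟩
    refine (hleft hL).elim id fun h => ?_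
    exact (isoToMember_sumLex_of_isEmpty_left hR).1 ((hgap (.inr hL)).resolve_right (h₂ h))
  · refine ⟨3, ?_, not_nonempty_iff.1 hL⟩
    refine (hright hR).elim id fun h => ?_
    exact (isoToMember_sumLex_of_isEmpty_right hL).1 ((hgap (.inl hR)).resolve_right (h₁ h))
  · exact ⟨1, not_nonempty_iff.1 hL, not_nonempty_iff.1 hR⟩

theorem IsMinimalCollection.leftAbsorbs_of_endCondition [Countable A] [Countable L] [Countable R]
    (hI : IsMinimalCollection I c) :
    (EndCondition I L R 1 → (LeftAbsorbs (L ⊕ₗ (Shuffle I c ⊕ₗ R)) A ↔ Nonempty A)) ∧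
    (EndCondition I L R 2 → (LeftAbsorbs (L ⊕ₗ (Shuffle I c ⊕ₗ R)) A ↔ HasLeftEndpoint A)) ∧
    (EndCondition I L R 3 → (LeftAbsorbs (L ⊕ₗ (Shuffle I c ⊕ₗ R)) A ↔ HasRightEndpoint A)) ∧
    (EndCondition I L R 4 → (LeftAbsorbs (L ⊕ₗ (Shuffle I c ⊕ₗ R)) A ↔
      A ≅ₒ (Unit ⊕ₗ (ℚ ⊕ₗ Unit)) ∨ A ≅ₒ Unit)) ∧
    (EndCondition I L R 5 → (LeftAbsorbs (L ⊕ₗ (Shuffle I c ⊕ₗ R)) A ↔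
      HasLeftEndpoint A ∧ HasRightEndpoint A ∧ HasSuccessors A ∧ HasPredecessors A)) ∧
    (EndCondition I L R 6 → (LeftAbsorbs (L ⊕ₗ (Shuffle I c ⊕ₗ R)) A ↔
      HasLeftEndpoint A ∧ HasRightEndpoint A ∧ HasSuccessors A)) ∧
    (EndCondition I L R 7 → (LeftAbsorbs (L ⊕ₗ (Shuffle I c ⊕ₗ R)) A ↔
      HasLeftEndpoint A ∧ HasRightEndpoint A ∧ HasPredecessors A)) ∧
    (EndCondition I L R 8 → (LeftAbsorbs (L ⊕ₗ (Shuffle I c ⊕ₗ R)) A ↔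
      HasLeftEndpoint A ∧ HasRightEndpoint A)) := by
  have h₁ : IsoToMember I L → Nonempty L := hI.nonempty_of_isoToMember
  have h₂ : IsoToMember I R → Nonempty R := hI.nonempty_of_isoToMember
  have h₃ := isoToMember_sumLex_of_isEmpty_left (I := I) (L := L) (R := R)
  have h₄ := isoToMember_sumLex_of_isEmpty_right (I := I) (L := L) (R := R)
  have h₅ : HasLeftEndpoint A → Nonempty A := fun ⟨a, _⟩ => ⟨a⟩
  have h₆ : HasRightEndpoint A → Nonempty A := fun ⟨a, _⟩ => ⟨a⟩
  rw [← ordIso_of_endpoints_of_not_covBy_iff]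
  refine ⟨fun h => ?_, fun h => ?_, fun h => ?_, fun h => ?_, fun h => ?_, fun h => ?_,
    fun h => ?_, fun h => ?_⟩ <;>
  · have hLR := hI.not_hasCopy_of_endCondition h
    rw [hI.leftAbsorbs_iff hLR.1 hLR.2, endsAreMembers_iff]
    clear hLR
    simp only [EndCondition, ← not_nonempty_iff] at h
    by_cases hL : Nonempty L <;> by_cases hR : Nonempty R <;>
      simp only [hL, hR, true_or, or_true, or_self, true_imp_iff, false_imp_iff, not_true,
        not_false_iff] at * <;> tauto

end Cases

/-! ### Orders that absorb every countable order -/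

section Shuffles

/-- Neither minimality nor non-emptiness of the members is needed for a shuffle to absorb every
non-empty countable order: the product is again a shuffle of the same collection. -/
theorem prodLex_shuffle_ordIso {K : Type} {I : K → Type u} [∀ k, LinearOrder (I k)] {c : ℚ → K}
    (hc : IsDensePartition c) (A : Type u) [LinearOrder A] [Countable A] [Nonempty A] :
    (A ×ₗ Shuffle I c) ≅ₒ Shuffle I c := by
  have : Countable (A ×ₗ ℚ) := inferInstanceAs (Countable (A × ℚ))
  have : Nonempty (A ×ₗ ℚ) := inferInstanceAs (Nonempty (A × ℚ))
  have h₁ : (A ×ₗ Shuffle I c) ≅ₒ (Σₗ p : A ×ₗ ℚ, I (c (ofLex p).2)) := by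
    refine StrictMono.ordIso (g := fun x : A ×ₗ Shuffle I c =>
      (toLex ⟨toLex ((ofLex x).1, (ofLex (ofLex x).2).1), (ofLex (ofLex x).2).2⟩ :
        Σₗ p : A ×ₗ ℚ, I (c (ofLex p).2))) ?_ ?_
    · rintro ⟨a, q, x⟩ ⟨b, r, y⟩ hxy
      rcases hxy with ⟨_, _, hab⟩ | ⟨_, hxy⟩
      · exact Sigma.Lex.left _ _ (Prod.Lex.left _ _ hab)
      · rcases hxy with ⟨_, _, hqr⟩ | ⟨_, _, hxy⟩
        · exact Sigma.Lex.left _ _ (Prod.Lex.right _ hqr)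
        · exact Sigma.Lex.right _ _ hxy
    · rintro ⟨⟨a, q⟩, x⟩
      exact ⟨toLex (a, toLex ⟨q, x⟩), rfl⟩
  have hk : ∀ {k l : K}, k = l → I k ≅ₒ I l := by
    rintro k _ rfl
    exact ⟨OrderIso.refl _⟩
  refine h₁.trans (sigmaLex_ordIso_of_dense (fun p x y hxy => ?_) fun q p p' hp => ?_)
  · obtain ⟨r, hxr, hry, hr⟩ := hc.exists_between (c (ofLex p).2) hxy
    exact ⟨r, hxr, hry, hk hr.symm⟩
  · rcases Prod.Lex.lt_iff.1 hp with h | ⟨h, h'⟩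
    · obtain ⟨r, hr, -, hr'⟩ := hc.exists_between (c q) (lt_add_one (ofLex p).2)
      exact ⟨toLex ((ofLex p).1, r), Prod.Lex.lt_iff.2 (.inr ⟨rfl, hr⟩),
        Prod.Lex.lt_iff.2 (.inl h), hk hr'⟩
    · obtain ⟨r, hr, hr₂, hr'⟩ := hc.exists_between (c q) h'
      exact ⟨toLex ((ofLex p).1, r), Prod.Lex.lt_iff.2 (.inr ⟨rfl, hr⟩),
        Prod.Lex.lt_iff.2 (.inr ⟨h, hr₂⟩), hk hr'⟩

/-- If `ℚ X ≅ X`, then `X` is the shuffle of the single order `X`. -/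
theorem LeftAbsorbs.isShuffle {X : Type u} [LinearOrder X] [Countable X]
    (h : LeftAbsorbs X (ULift.{u} ℚ)) : IsShuffle X := by
  refine ⟨Unit, fun _ => X, fun _ => inferInstance, fun _ => (), inferInstance,
    fun _ => inferInstance, fun _ => by simp, h.symm.trans ?_⟩
  refine StrictMono.ordIso (g := fun x : ULift.{u} ℚ ×ₗ X =>
    (toLex ⟨(ofLex x).1.down, (ofLex x).2⟩ : Σₗ _ : ℚ, X)) ?_ ?_
  · rintro ⟨a, x⟩ ⟨b, y⟩ hxy
    rcases hxy with ⟨_, _, hab⟩ | ⟨_, hxy⟩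
    · exact Sigma.Lex.left _ _ hab
    · exact Sigma.Lex.right _ _ hxy
  · rintro ⟨q, x⟩
    exact ⟨toLex (⟨q⟩, x), rfl⟩

end Shuffles

/-! ### Characterization of the left-absorbing orders -/

/-- Two points, or `1 + ℚ + 1` in the fourth case, are absorbed. -/
theorem IsMinimalCollection.leftAbsorbing_of_endCondition {K : Type} {I : K → Type u}
    [∀ k, LinearOrder (I k)] {c : ℚ → K} {L R : Type u} [LinearOrder L] [LinearOrder R]
    [Countable L] [Countable R] (hI : IsMinimalCollection I c) {n : ℕ}
    (h : EndCondition I L R n) : LeftAbsorbing (L ⊕ₗ (Shuffle I c ⊕ₗ R)) := by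
  have h₁ : HasLeftEndpoint (ULift.{u} Bool) := ⟨⟨false⟩, fun _ => Bool.false_le _⟩
  have h₂ : HasRightEndpoint (ULift.{u} Bool) := ⟨⟨true⟩, fun _ => Bool.le_true _⟩
  have hcov : (⟨false⟩ : ULift.{u} Bool) ⋖ ⟨true⟩ := by
    refine ⟨Bool.false_lt_true, ?_⟩
    rintro ⟨_ | _⟩ h h'
    exacts [lt_irrefl _ h, lt_irrefl _ h']
  have h₃ : HasSuccessors (ULift.{u} Bool) := by
    rintro ⟨_ | _⟩ h
    exacts [⟨_, hcov⟩, absurd (fun _ => Bool.le_true _) h]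
  have h₄ : HasPredecessors (ULift.{u} Bool) := by
    rintro ⟨_ | _⟩ h
    exacts [absurd (fun _ => Bool.false_le _) h, ⟨_, hcov⟩]
  obtain ⟨c₁, c₂, c₃, -, c₅, c₆, c₇, c₈⟩ :=
    hI.leftAbsorbs_of_endCondition (A := ULift.{u} Bool) (L := L) (R := R)
  match n, h with
  | 1, h => exact ⟨_, _, inferInstance, (c₁ h).2 inferInstance⟩
  | 2, h => exact ⟨_, _, inferInstance, (c₂ h).2 h₁⟩
  | 3, h => exact ⟨_, _, inferInstance, (c₃ h).2 h₂⟩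
  | 4, h =>
    have : Countable (Unit ⊕ₗ (ℚ ⊕ₗ Unit)) := inferInstanceAs (Countable (Unit ⊕ (ℚ ⊕ Unit)))
    have : Nontrivial (Unit ⊕ₗ (ℚ ⊕ₗ Unit)) := inferInstanceAs (Nontrivial (Unit ⊕ (ℚ ⊕ Unit)))
    exact ⟨ULift.{u} (Unit ⊕ₗ (ℚ ⊕ₗ Unit)), inferInstance, inferInstance,
      (hI.leftAbsorbs_of_endCondition.2.2.2.1 h).2 (.inl ⟨ULift.orderIso⟩)⟩
  | 5, h => exact ⟨_, _, inferInstance, (c₅ h).2 ⟨h₁, h₂, h₃, h₄⟩⟩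
  | 6, h => exact ⟨_, _, inferInstance, (c₆ h).2 ⟨h₁, h₂, h₃⟩⟩
  | 7, h => exact ⟨_, _, inferInstance, (c₇ h).2 ⟨h₁, h₂, h₄⟩⟩
  | 8, h => exact ⟨_, _, inferInstance, (c₈ h).2 ⟨h₁, h₂⟩⟩

theorem LeftAbsorbs.countable {X A : Type u} [LinearOrder X] [LinearOrder A] [Countable X]
    [Nonempty X] (h : LeftAbsorbs X A) : Countable A := by
  obtain ⟨e⟩ := h
  obtain ⟨x⟩ := ‹Nonempty X›
  refine Function.Injective.countable (f := fun a => e (toLex (a, x))) fun a b hab => ?_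
  exact (Prod.ext_iff.1 (toLex.injective (e.injective hab))).1

theorem theorem2 (X : Type u) [LinearOrder X] [Countable X] [Nonempty X] :
    -- the characterization of left-absorption
    (LeftAbsorbing X ↔
      ∃ (K : Type) (I : K → Type u) (_ : ∀ k, LinearOrder (I k)) (c : ℚ → K)
        (L R : Type u) (_ : LinearOrder L) (_ : LinearOrder R),
        IsMinimalCollection I c ∧ Countable L ∧ Countable R ∧
        X ≅ₒ (L ⊕ₗ (Shuffle I c ⊕ₗ R)) ∧
        ∃! n : ℕ, EndCondition I L R n) ∧
    -- the orders absorbed, for every such representation of `X`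
    (∀ (K : Type) (I : K → Type u) [∀ k, LinearOrder (I k)] (c : ℚ → K)
        (L R : Type u) [LinearOrder L] [LinearOrder R],
        IsMinimalCollection I c → Countable L → Countable R →
        X ≅ₒ (L ⊕ₗ (Shuffle I c ⊕ₗ R)) →
        ∀ (A : Type u) [LinearOrder A] [Countable A],
          (EndCondition I L R 1 → (LeftAbsorbs X A ↔ Nonempty A)) ∧
          (EndCondition I L R 2 → (LeftAbsorbs X A ↔ HasLeftEndpoint A)) ∧
          (EndCondition I L R 3 → (LeftAbsorbs X A ↔ HasRightEndpoint A)) ∧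
          (EndCondition I L R 4 → (LeftAbsorbs X A ↔ A ≅ₒ (Unit ⊕ₗ (ℚ ⊕ₗ Unit)) ∨ A ≅ₒ Unit)) ∧
          (EndCondition I L R 5 → (LeftAbsorbs X A ↔
            HasLeftEndpoint A ∧ HasRightEndpoint A ∧ HasSuccessors A ∧ HasPredecessors A)) ∧
          (EndCondition I L R 6 → (LeftAbsorbs X A ↔
            HasLeftEndpoint A ∧ HasRightEndpoint A ∧ HasSuccessors A)) ∧
          (EndCondition I L R 7 → (LeftAbsorbs X A ↔
            HasLeftEndpoint A ∧ HasRightEndpoint A ∧ HasPredecessors A)) ∧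
          (EndCondition I L R 8 → (LeftAbsorbs X A ↔
            HasLeftEndpoint A ∧ HasRightEndpoint A))) ∧
    -- the orders that absorb every countable order are the shuffles
    ((∀ (A : Type u) [LinearOrder A] [Countable A] [Nonempty A], LeftAbsorbs X A) ↔ IsShuffle X) := by
  refine ⟨⟨fun h => ?_, ?_⟩, ?_, fun h => (h (ULift.{u} ℚ)).isShuffle, ?_⟩
  · obtain ⟨K, I, _, c, L, R, _, _, hI, _, _, hX, hL, hR⟩ := h.selfDoubling.exists_decomposition
    obtain ⟨A, _, _, hA⟩ := h
    have := hA.countable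
    rw [LeftAbsorbs.congr hX, hI.leftAbsorbs_iff hL hR] at hA
    obtain ⟨n, hn⟩ := hA.2.2.2.exists_endCondition
    exact ⟨K, I, _, c, L, R, _, _, hI, inferInstance, inferInstance, hX, n, hn,
      fun m hm => hI.endCondition_unique hm hn⟩
  · rintro ⟨K, I, _, c, L, R, _, _, hI, _, _, hX, n, hn, -⟩
    obtain ⟨A, _, hA, h⟩ := hI.leftAbsorbing_of_endCondition hn
    exact ⟨A, _, hA, (LeftAbsorbs.congr hX).2 h⟩
  · intro K I _ c L R _ _ hI _ _ hX A _ _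
    simp only [LeftAbsorbs.congr hX]
    exact hI.leftAbsorbs_of_endCondition
  · rintro ⟨K, I, _, c, -, -, hc, hX⟩ A _ _ _
    exact (LeftAbsorbs.congr hX).2 (prodLex_shuffle_ordIso hc A)
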